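/- All structures are relational, over a finite signature, and have a non-empty domain; $|x|$ denotes the length of a word $x$. A finite $\tau$-structure with domain $\{0,\dots,n-1\}$ is encoded as a word over $\{0,1\}$ by writing $n$ in unary, followed by $0$, followed by the truth tables of the relations (in any fixed enumeration of the symbols of $\tau$). A class $\mathcal C$ of finite $\tau$-structures is identified with the set of words that encode a structure from $\mathcal C$. An existential second-order (ESO) $\tau$-sentence $\Psi=\exists R_1,\dots,R_m\,(\phi_1\wedge\dots\wedge\phi_\ell)$, with first-order $\tau\cup\{R_1,\dots,R_m\}$-sentences $\phi_i$, is called *extensional* if for every quantified symbol $R$ there is a distinct symbol $R'\in\tau$ of the same arity such that $\forall \bar x\,(R'(\bar x)\Rightarrow R(\bar x))$ is a conjunct of $\Psi$ and $R'$ does not appear anywhere else in $\Psi$. A class $\mathcal C$ of finite $\tau$-structures is *expressible in extensional ESO* if it is the class of finite models of some extensional ESO $\tau$-sentence. A strict partial order $<$ on $\{0,1\}^*$ is *OK* if it is decidable in polynomial time and there is a polynomial $p$ such that (i) $n\le p(|x_n|)$ for every chain $x_1<\dots<x_n$ of words, and (ii) $x<y$ implies $|x|\le p(|y|)$. A set $L\subseteq\{0,1\}^*$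 is *disjunctive self-reducible* if there are an OK partial order $<$ and a deterministic polynomial-time oracle Turing machine $M$ that accepts $L$ when it is given the oracle $L$, and such that on every input $x$ the machine $M$ either decides whether $x\in L$ without calling the oracle, or computes queries $x_1,\dots,x_n$ (independently of the answers of the oracle), all strictly smaller than $x$ with respect to $<$, such that $x\in L$ if and only if $\{x_1,\dots,x_n\}\cap L\ne\varnothing$. A (possibly infinite) structure $\mathbb B$ is *finitely bounded* if there is a finite set $\mathcal F$ of finite structures such that a finite structure $\mathbb A$ embeds into $\mathbb B$ if and only if no structure from $\mathcal F$ embeds into $\mathbb A$; and $\mathrm{CSP}(\mathbb B)$ is the class of finite structures that have a homomorphism to $\mathbb B$. **Lemma.** Let $\tau$ be a finite relational signature. If a class $\mathcal C$ of finite $\tau$-structures is expressible in extensional ESO, then $\mathcal C$ is disjunctive self-reducible. In particular, for every finitely bounded $\tau$-structure $\mathbb B$, $\mathrm{CSP}(\mathbb B)$ is disjunctive self-reducible. -/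

import Mathlib

/-! ### Disjunctive self-reducible sets of words over `{0,1}` -/

namespace SelfRed

open CategoryTheory
open scoped FirstOrder

/-- Words over the alphabet `{0,1}`. -/
abbrev Word : Type := List Bool

/-- The binary relation `r` on words is decidable in (deterministic) polynomial time:
its characteristic function is computed by a polynomial-time Turing machine, where a pair `(x, y)`
is given by the letters of `x` followed by the letters of `y` (in a second copy of the alphabet). -/
def PolyTimeDecidable (r : Word → Word → Prop) : Prop :=
  ∃ f : Word × Word → Bool, (∀ x y, f (x, y) = true ↔ r x y) ∧
    Nonempty (Turing.TM2ComputableInPolyTime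
      (Computability.encodingProd (Computability.encodingList Bool)
        (Computability.encodingList Bool)).encode
      Computability.encodeBool f)

/-- `lt` is (the strict part of) an *OK* partial order on `{0,1}*`. -/
structure IsOK (lt : Word → Word → Prop) : Prop where
  /-- `lt` is irreflexive and transitive. -/
  isStrictOrder : IsStrictOrder Word lt
  polyTimeDecidable : PolyTimeDecidable lt
  /-- One polynomial `p` bounds the number of elements of each finite chain `x₁ < ⋯ < xₙ = x`
  by `p(|x|)`, and the length of each `x < y` by `p(|y|)`. -/
  bounded : ∃ p : Polynomial ℕ,
    (∀ (l : List Word) (x : Word), (l ++ [x]).Pairwise lt →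
      (l ++ [x]).length ≤ p.eval x.length) ∧
    (∀ x y : Word, lt x y → x.length ≤ p.eval y.length)

/-- A deterministic oracle Turing machine. It is a multi-stack (multi-tape) machine with a
designated query stack `kq`. Some labels are query labels: `query ℓ = some (ℓ₁, ℓ₀)` means that at
label `ℓ` the machine asks its oracle about the word on the query stack, and goes on at `ℓ₁` if the
answer is "yes" and at `ℓ₀` if the answer is "no". At the other labels it runs its program. -/
structure OracleMachine extends Turing.FinTM2 where
  /-- All alphabets are finite. -/
  finiteAlphabets : ∀ k, Finite (Γ k)
  /-- The input alphabet is `{0,1}`. -/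
  inputAlphabet : Γ k₀ ≃ Bool
  /-- The output alphabet is `{0,1}`. -/
  outputAlphabet : Γ k₁ ≃ Bool
  /-- The query stack. -/
  kq : K
  /-- The query alphabet is `{0,1}`. -/
  queryAlphabet : Γ kq ≃ Bool
  /-- The query labels, with the continuations for the answers "yes" and "no". -/
  query : Λ → Option (Λ × Λ)

namespace OracleMachine

variable (M : OracleMachine)

open Classical in
/-- One step of the machine with oracle `O`. The second component of the state
lists the queries that have been asked so far; the machine itself has no access to it. A query takes
one step and empties the query stack. -/
noncomputable def step (O : Set Word) :
    M.toFinTM2.Cfg × List Word → Option (M.toFinTM2.Cfg × List Word)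
  | (⟨none, _, _⟩, _) => none
  | (⟨some ℓ, v, S⟩, qs) =>
    match M.query ℓ with
    | none => (M.toFinTM2.step ⟨some ℓ, v, S⟩).map fun c => (c, qs)
    | some (yes, no) =>
      let w : Word := (S M.kq).map M.queryAlphabet
      some (⟨some (if w ∈ O then yes else no), v, Function.update S M.kq []⟩, qs ++ [w])

/-- Started on input `x` with oracle `O`, the machine halts after at most `t` steps with output `b`,
and the queries it asks on the way are `qs`, in this order. -/
def Run (O : Set Word) (x : Word) (b : Bool) (qs : List Word) (t : ℕ) : Prop :=
  Nonempty (StateTransition.EvalsToInTime (M.step O)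
    (Turing.initList M.toFinTM2 (x.map M.inputAlphabet.symm), [])
    (some (Turing.haltList M.toFinTM2 [M.outputAlphabet.symm b], qs)) t)

/-- The machine halts in polynomial time (on every input and with every oracle), with output
`0` or `1`. -/
def PolyTime : Prop :=
  ∃ p : Polynomial ℕ, ∀ (O : Set Word) (x : Word), ∃ (b : Bool) (qs : List Word),
    M.Run O x b qs (p.eval x.length)

/-- The machine with oracle `L` accepts `L`, and on input `x` it asks only about words
smaller than `x`. -/
def SelfReduces (lt : Word → Word → Prop) (L : Set Word) : Prop :=
  ∀ (x : Word) (b : Bool) (qs : List Word) (t : ℕ), M.Run L x b qs t →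
    (b = true ↔ x ∈ L) ∧ ∀ q ∈ qs, lt q x

/-- On every input `x`, the machine computes a list of queries (which does not depend on the
answers of the oracle); either this list is empty, i.e. the machine decides without calling the
oracle, or `x` belongs to `L` if and only if one of the queries does. -/
def Disjunctive (L : Set Word) : Prop :=
  ∀ x : Word, ∃ qs : List Word,
    (∀ (O : Set Word) (b : Bool) (qs' : List Word) (t : ℕ), M.Run O x b qs' t → qs' = qs) ∧
    (qs = [] ∨ (x ∈ L ↔ ∃ q ∈ qs, q ∈ L))

end OracleMachine

/-- `L` is self-reducible. -/
def SelfReducible (L : Set Word) : Prop :=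
  ∃ lt : Word → Word → Prop, IsOK lt ∧
    ∃ M : OracleMachine, M.PolyTime ∧ M.SelfReduces lt L

/-- `L` is disjunctive self-reducible (with respect to some OK partial order). -/
def DisjunctiveSelfReducible (L : Set Word) : Prop :=
  ∃ lt : Word → Word → Prop, IsOK lt ∧
    ∃ M : OracleMachine, M.PolyTime ∧ M.SelfReduces lt L ∧ M.Disjunctive L

/-! ### Finite structures as words -/

open Classical in
/-- The encoding of a structure with domain `{0, …, n-1}` in a signature whose relation symbols are
enumerated by `e`: the number `n` in unary, closed by a `0`, and then for each relation symbol
`R` of arity `r` its table of `n ^ r` bits, in which the tuple `a` has the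
position `∑ i, a i * n ^ i`. -/
noncomputable def encodeStructure {τ : FirstOrder.Language.{0, 0}} {k : ℕ}
    (e : Fin k ≃ Σ r, τ.Relations r) (n : ℕ) (S : τ.Structure (Fin n)) : Word :=
  List.replicate n true ++ [false] ++
    (List.finRange k).flatMap fun i =>
      List.ofFn fun j : Fin (n ^ (e i).1) =>
        decide (S.RelMap (e i).2 (finFunctionFinEquiv.symm j))

/-- The set of words that encode a (finite, non-empty) structure from the class `C`. -/
def wordsOf {τ : FirstOrder.Language.{0, 0}} {k : ℕ} (e : Fin k ≃ Σ r, τ.Relations r)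
    (C : Set (Bundled.{0} τ.Structure)) : Set Word :=
  {w | ∃ (n : ℕ) (S : τ.Structure (Fin n)), 0 < n ∧ (⟨Fin n, S⟩ : Bundled τ.Structure) ∈ C ∧
    w = encodeStructure e n S}

/-! ### Extensional existential second-order logic -/

/-- The relation symbol `s` occurs in the formula. -/
def Occurs {L : FirstOrder.Language.{0, 0}} {α : Type} (s : Σ r, L.Relations r) :
    ∀ {n : ℕ}, L.BoundedFormula α n → Prop
  | _, .falsum => False
  | _, .equal _ _ => False
  | _, .rel (l := r) R _ => s = ⟨r, R⟩
  | _, .imp φ ψ => Occurs s φ ∨ Occurs s ψ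
  | _, .all φ => Occurs s φ

/-- An existential second-order `τ`-sentence `∃ R₁ … Rₘ (φ₁ ∧ ⋯ ∧ φₗ)`: the quantified
relation symbols form the finite relational signature `σ`, and the `φᵢ` are first-order
`(τ ∪ σ)`-sentences. -/
structure ESOSentence (τ : FirstOrder.Language.{0, 0}) where
  /-- The signature of the existentially quantified symbols. -/
  σ : FirstOrder.Language.{0, 0}
  relational : σ.IsRelational
  finite : Finite (Σ r, σ.Relations r)
  /-- The conjuncts of the first-order part. -/
  conjuncts : List (τ.sum σ).Sentence

/-- The structure `A` satisfies the existential second-order sentence `Ψ`. -/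
def ESOSentence.Realize {τ : FirstOrder.Language.{0, 0}} (Ψ : ESOSentence τ) (A : Type)
    [τ.Structure A] : Prop :=
  ∃ _ : Ψ.σ.Structure A, ∀ φ ∈ Ψ.conjuncts, A ⊨ φ

/-- The `(τ ∪ σ)`-sentence `∀ x₁ … xᵣ (R'(x₁, …, xᵣ) ⇒ R(x₁, …, xᵣ))`. -/
def extensionConjunct {τ σ : FirstOrder.Language.{0, 0}} {r : ℕ} (R' : τ.Relations r)
    (R : σ.Relations r) : (τ.sum σ).Sentence :=
  FirstOrder.Language.BoundedFormula.alls (n := r)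
    (FirstOrder.Language.BoundedFormula.imp
      (.rel (L := τ.sum σ) (Sum.inl R') fun i => .var (Sum.inr i))
      (.rel (L := τ.sum σ) (Sum.inr R) fun i => .var (Sum.inr i)))

/-- `Ψ` is extensional: for every quantified symbol `R` there is a distinct symbol `R' ∈ τ`
of the same arity such that `∀ x̄ (R'(x̄) ⇒ R(x̄))` is a conjunct of `Ψ` and `R'` occurs in no other
conjunct. -/
def ESOSentence.IsExtensional {τ : FirstOrder.Language.{0, 0}} (Ψ : ESOSentence τ) : Prop :=
  ∃ prime : ∀ r, Ψ.σ.Relations r → τ.Relations r,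
    (∀ r, Function.Injective (prime r)) ∧
    ∀ (r : ℕ) (R : Ψ.σ.Relations r),
      extensionConjunct (prime r R) R ∈ Ψ.conjuncts ∧
      ∀ φ ∈ Ψ.conjuncts, φ ≠ extensionConjunct (prime r R) R →
        ¬ Occurs (L := τ.sum Ψ.σ) ⟨r, Sum.inl (prime r R)⟩ φ

/-- The class `C` of finite `τ`-structures is expressible in extensional ESO:
its members are exactly the finite non-empty models of some extensional sentence. -/
def ExpressibleInExtESO {τ : FirstOrder.Language.{0, 0}}
    (C : Set (Bundled.{0} τ.Structure)) : Prop :=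
  ∃ Ψ : ESOSentence τ, Ψ.IsExtensional ∧
    ∀ A : Bundled.{0} τ.Structure, A ∈ C ↔ Finite A ∧ Nonempty A ∧ Ψ.Realize A

/-! ### Constraint satisfaction problems -/

/-- `CSP(B)`: the finite (non-empty) structures that map homomorphically to `B`. -/
def CSP {τ : FirstOrder.Language.{0, 0}} (B : Type*) [τ.Structure B] :
    Set (Bundled.{0} τ.Structure) :=
  {A | Finite A ∧ Nonempty A ∧ Nonempty (A →[τ] B)}

/-- `B` is finitely bounded: there is a finite set `F` of finite structures such that a finite
structure embeds into `B` if and only if no member of `F` embeds into it. -/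
def FinitelyBounded (τ : FirstOrder.Language.{0, 0}) (B : Type*) [τ.Structure B] : Prop :=
  ∃ F : Set (Bundled.{0} τ.Structure), F.Finite ∧ (∀ X ∈ F, Finite X ∧ Nonempty X) ∧
    ∀ A : Bundled.{0} τ.Structure, Finite A → Nonempty A →
      (Nonempty (A ↪[τ] B) ↔ ∀ X ∈ F, IsEmpty (X ↪[τ] A))

end SelfRed

/-! Let `Ψ` be extensional and let `S` be a finite structure. The smallest candidate for a witness
interprets every quantified symbol `R` by the relation of its partner `R'` in `S`
(`primeStructure`). If it satisfies the first-order part, then `S` is in the class, and no query is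
needed. Otherwise every witness `T` contains a tuple of some `R` that is missing from `R'`. The
symbol `R'` constrains `T` only through `R' ⊆ R`, so `T` remains a witness when this tuple is added
to `R'`. Conversely, a witness for the enlarged structure is also a witness for `S`. Hence `S` is in
the class if and only if one of the structures obtained by adding one missing tuple to one `R'` is
(`ESOSentence.Models.congr`, `exists_models_iff`).

On words, adding a tuple turns one zero of the encoding into a one, and the tables occupy disjoint
places (`decodeStructure_set`). The partial order is `MoreOnes`: `y < x` if `y` arises from `x` by
turning zeros into ones. Lengths do not change, the number of ones grows strictly along decreasing
steps, so chains have at most `|x| + 1` elements, and the order is decided by a letterwise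
comparison (`isOK_moreOnes`).

The definition asks for an actual oracle Turing machine. The reduction is therefore written as a
formula of a small language `Fml`, whose atoms read the letter of the input at a position given by a
polynomial in the domain size and the values of the variables, or query the oracle after setting
such a letter to one. A formula is turned into a program (`Fml.prog`), which runs in polynomial time
(`runs_prog`), and a program into an oracle machine whose labels are the lists of programs still to
be executed (`Prog.machine_run`). Conjunctions and quantifiers are evaluated without
short-circuiting, and all branching in `reductionFml` that decides which words are asked about is
free of the oracle, so the queries do not depend on the answers.

For a finitely bounded `B` with bounds `F`, a finite structure `A` maps to `B` if and only if its
relations can be enlarged so that the quotient by exchangeability of elements embeds no member of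
`F` (`nonempty_hom_iff`). The quotient is needed since homomorphisms may identify elements;
exchangeability is first-order definable, and so is the absence of a copy of a bound with pairwise
non-exchangeable elements. Quantifying over a second copy of `τ` turns this into an extensional
sentence (`expressibleInExtESO_CSP`). -/

namespace SelfRed

open Turing StateTransition

/-! ### A small programming language for oracle machines -/

section EvalsTo

variable {α : Type*} {f : α → Option α} {a b c : α}

theorem evalsToInTime_mono {x : Option α} {s t : ℕ} (h : Nonempty (EvalsToInTime f a x s))
    (hst : s ≤ t) : Nonempty (EvalsToInTime f a x t) :=
  h.map fun e => ⟨e.toEvalsTo, e.steps_le_m.trans hst⟩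

theorem evalsToInTime_one {x : Option α} (h : f a = x) : Nonempty (EvalsToInTime f a x 1) :=
  ⟨⟨⟨1, h⟩, le_rfl⟩⟩

theorem evalsToInTime_trans {x : Option α} {s t : ℕ} (h : Nonempty (EvalsToInTime f a (some b) s))
    (h' : Nonempty (EvalsToInTime f b x t)) : Nonempty (EvalsToInTime f a x (s + t)) := by
  obtain ⟨e⟩ := h
  obtain ⟨e'⟩ := h'
  exact evalsToInTime_mono ⟨EvalsToInTime.trans f _ _ _ _ _ e e'⟩ (by omega)

theorem iterate_bind_none (f : α → Option α) (n : ℕ) : (flip bind f)^[n] none = none := by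
  induction n with
  | zero => rfl
  | succ n ih => rw [Function.iterate_succ_apply]; exact ih

/-- A deterministic computation has at most one halting configuration. -/
theorem evalsTo_unique (hb : f b = none) (hc : f c = none)
    (h : EvalsTo f a (some b)) (h' : EvalsTo f a (some c)) : b = c := by
  obtain ⟨m, hm⟩ := h
  obtain ⟨n, hn⟩ := h'
  -- If one computation stopped strictly earlier than the other, iterating past its halting
  -- configuration would give `none`.
  have key : ∀ {b c : α} {m n : ℕ}, f b = none → (flip bind f)^[m] (some a) = some b →
      (flip bind f)^[n] (some a) = some c → m < n → False := by
    intro b c m n hb hm hn hlt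
    obtain ⟨d, rfl⟩ := Nat.exists_eq_add_of_lt hlt
    rw [show m + d + 1 = d + (m + 1) by omega, Function.iterate_add_apply,
      Function.iterate_succ_apply' _ m, hm, show flip bind f (some b) = none from hb,
      iterate_bind_none] at hn
    cases hn
  rcases lt_trichotomy m n with hlt | rfl | hlt
  · exact (key hb hm hn hlt).elim
  · exact Option.some_injective _ (hm.symm.trans hn)
  · exact (key hc hn hm hlt).elim

end EvalsTo

/-- `SelfReduces` and `Disjunctive` speak about all runs; by determinism it suffices to exhibit one
run for each oracle and input. -/
theorem OracleMachine.Run.unique {M : OracleMachine} {O : Set Word} {x : Word} {b b' : Bool}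
    {qs qs' : List Word} {t t' : ℕ} (h : M.Run O x b qs t) (h' : M.Run O x b' qs' t') :
    b = b' ∧ qs = qs' := by
  obtain ⟨h⟩ := h
  obtain ⟨h'⟩ := h'
  have key := evalsTo_unique rfl rfl h.toEvalsTo h'.toEvalsTo
  refine ⟨?_, congrArg Prod.snd key⟩
  have h1 := congrArg (fun c => c.1.stk M.k₁) key
  simpa [haltList] using h1

/-- The stacks of our machines. -/
inductive Stack
  /-- the input -/
  | inp
  /-- the reversed part of the input to the left of the head -/
  | rev
  /-- the size of the domain in unary -/
  | dim
  /-- a position in the input in unary -/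
  | pos
  /-- auxiliary storage -/
  | tmp
  /-- truth values -/
  | res
  /-- the query -/
  | qry
  /-- the value of a variable in unary -/
  | var (i : ℕ)
  /-- the size of the domain minus the value of a variable in unary -/
  | cov (i : ℕ)
  /-- loop counters -/
  | cnt (d : ℕ)
  deriving DecidableEq

/-- The contents of the stacks and the list of queries asked so far. -/
@[ext]
structure Conf where
  /-- the stacks -/
  stk : Stack → Word
  /-- the queries asked so far -/
  log : List Word

namespace Conf

/-- Replace the contents of a stack. -/
def set (s : Conf) (k : Stack) (w : Word) : Conf := ⟨Function.update s.stk k w, s.log⟩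

/-- Push a bit onto several stacks. -/
def pushAll (b : Bool) : List Stack → Conf → Conf
  | [], s => s
  | k :: ks, s => pushAll b ks (s.set k (b :: s.stk k))

/-- Move the top of the stack `k` to several other stacks. -/
def move (s : Conf) (k : Stack) (ks : List Stack) : Conf :=
  match s.stk k with
  | [] => s
  | b :: w => pushAll b ks (s.set k w)

end Conf

/-- Programs. -/
inductive Prog
  | push (k : Stack) (b : Bool)
  | move (k : Stack) (ks : List Stack)
  | seq (p q : Prog)
  | branch (k : Stack) (c : Option Bool → Bool) (p q : Prog)
  | loop (k : Stack) (c : Option Bool → Bool) (p : Prog)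
  | query

open Classical in
/-- The program `p` with oracle `O` leads from `s` to `s'` in at most `t` steps. -/
inductive Runs (O : Set Word) : Prog → Conf → Conf → ℕ → Prop
  | push (k b s) : Runs O (.push k b) s (s.set k (b :: s.stk k)) 1
  | move (k ks s) : Runs O (.move k ks) s (s.move k ks) 1
  | seq {p q s s' s'' t t'} : Runs O p s s' t → Runs O q s' s'' t' →
      Runs O (.seq p q) s s'' (t + t' + 1)
  | branch_true {k c p q s s' t} : c (s.stk k).head? = true → Runs O p s s' t →
      Runs O (.branch k c p q) s s' (t + 1)
  | branch_false {k c p q s s' t} : c (s.stk k).head? = false → Runs O q s s' t →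
      Runs O (.branch k c p q) s s' (t + 1)
  | loop_done {k c p s} : c (s.stk k).head? = false → Runs O (.loop k c p) s s 1
  | loop_step {k c p s s' s'' t t'} : c (s.stk k).head? = true → Runs O p s s' t →
      Runs O (.loop k c p) s' s'' t' → Runs O (.loop k c p) s s'' (t + t' + 1)
  -- Two steps: the oracle call, which empties the query stack, and the push of the answer onto
  -- `res`.
  | query (s) : Runs O .query s ⟨Function.update (Function.update s.stk .qry []) .res
      (decide (s.stk .qry ∈ O) :: s.stk .res), s.log ++ [s.stk .qry]⟩ 2
  | mono {p s s' t t'} : Runs O p s s' t → t ≤ t' → Runs O p s s' t'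

namespace Prog

/-- The stacks of a program. -/
def usedStacks : Prog → Finset Stack
  | push k _ => {k}
  | move k ks => insert k ks.toFinset
  | seq p q => p.usedStacks ∪ q.usedStacks
  | branch k _ p q => insert k (p.usedStacks ∪ q.usedStacks)
  | loop k _ p => insert k p.usedStacks
  | query => {.qry, .res}

/-- The labels of a program that continues with the list `l` of programs. -/
def labels : Prog → List Prog → Set (List Prog)
  | push k b, l => {push k b :: l}
  | move k ks, l => {move k ks :: l}
  | seq p q, l => insert (seq p q :: l) (p.labels (q :: l) ∪ q.labels l)
  | branch k c p q, l => insert (branch k c p q :: l) (p.labels l ∪ q.labels l)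
  -- The body continues with the loop itself, so iterating creates no further labels and the set
  -- stays finite.
  | loop k c p, l => insert (loop k c p :: l) (p.labels (loop k c p :: l))
  | query, l => {query :: l, push .res true :: l, push .res false :: l}

theorem finite_labels (p : Prog) (l : List Prog) : (p.labels l).Finite := by
  induction p generalizing l with
  | push | move | query => simp [labels]
  | seq p q hp hq => exact ((hp _).union (hq _)).insert _
  | branch k c p q hp hq => exact ((hp _).union (hq _)).insert _
  | loop k c p hp => exact (hp _).insert _

theorem mem_labels (p : Prog) (l : List Prog) : p :: l ∈ p.labels l := by
  cases p <;> simp [labels]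

/-! ### Compiling programs into oracle machines -/

section Compile

variable {K Λ : Type} (ρ : Stack → K) (g : List Prog → Λ)

/-- Push the bit in the internal state onto several stacks and continue with `q`. -/
def pushStmt (q : TM2.Stmt (fun _ : K => Bool) Λ (Option Bool)) :
    List Stack → TM2.Stmt (fun _ : K => Bool) Λ (Option Bool)
  | [] => q
  | k :: ks => .push (ρ k) (fun v => v.getD false) (pushStmt q ks)

/-- The statement at a label. -/
def stmt : List Prog → TM2.Stmt (fun _ : K => Bool) Λ (Option Bool)
  | [] => .halt
  | push k b :: l => .push (ρ k) (fun _ => b) (.goto fun _ => g l)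
  -- Every letter read into the internal state is erased before the jump, so the state is `none`
  -- between instructions, as `cfg` requires.
  | move k ks :: l => .pop (ρ k) (fun _ o => o) (.branch Option.isSome
      (pushStmt ρ (.load (fun _ => none) (.goto fun _ => g l)) ks) (.goto fun _ => g l))
  | seq p q :: l => .goto fun _ => g (p :: q :: l)
  | branch k c p q :: l => .peek (ρ k) (fun _ o => o) (.branch c
      (.load (fun _ => none) (.goto fun _ => g (p :: l)))
      (.load (fun _ => none) (.goto fun _ => g (q :: l))))
  | loop k c p :: l => .peek (ρ k) (fun _ o => o) (.branch c
      (.load (fun _ => none) (.goto fun _ => g (p :: loop k c p :: l)))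
      (.load (fun _ => none) (.goto fun _ => g l)))
  -- Never executed: this is a query label, where the oracle acts in place of the program.
  | query :: l => .goto fun _ => g l

/-- The continuations at a query label. -/
def queryLabel : List Prog → Option (Λ × Λ)
  | query :: l => some (g (push .res true :: l), g (push .res false :: l))
  | _ => none

end Compile

/-- The stacks of the machine of a program. -/
def allStacks (p : Prog) : Finset Stack := insert .inp (insert .res (insert .qry p.usedStacks))

/-- The labels of the machine of a program. -/
def allLabels (p : Prog) : Set (List Prog) := insert [] (p.labels [])

theorem finite_allLabels (p : Prog) : p.allLabels.Finite := (p.finite_labels []).insert _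

/-- The stack of the machine that corresponds to `k`. -/
def toStack (p : Prog) (k : Stack) : {k // k ∈ p.allStacks} :=
  if h : k ∈ p.allStacks then ⟨k, h⟩ else ⟨.inp, by simp [allStacks]⟩

open Classical in
/-- The label of the machine that corresponds to `l`. -/
noncomputable def toLabel (p : Prog) (l : List Prog) : p.allLabels :=
  if h : l ∈ p.allLabels then ⟨l, h⟩ else ⟨[], by simp [allLabels]⟩

/-- The oracle machine of a program: the labels are the lists of programs that remain to be
executed. -/
noncomputable def machine (p : Prog) : OracleMachine where
  K := {k // k ∈ p.allStacks}
  k₀ := p.toStack .inp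
  k₁ := p.toStack .res
  kq := p.toStack .qry
  Γ _ := Bool
  Λ := p.allLabels
  ΛFin := p.finite_allLabels.fintype
  main := p.toLabel [p]
  σ := Option Bool
  initialState := none
  Γk₀Fin := inferInstanceAs (Fintype Bool)
  m l := stmt p.toStack p.toLabel l.1
  finiteAlphabets _ := inferInstanceAs (Finite Bool)
  inputAlphabet := Equiv.refl _
  outputAlphabet := Equiv.refl _
  queryAlphabet := Equiv.refl _
  query l := queryLabel p.toLabel l.1

/-- The configuration of the machine of `p` at the label `l`. -/
noncomputable def cfg (p : Prog) (l : List Prog) (s : Conf) :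
    p.machine.toFinTM2.Cfg × List Word :=
  (⟨some (p.toLabel l), none, fun k => s.stk k.1⟩, s.log)

theorem toLabel_val {p : Prog} {l : List Prog} (h : l ∈ p.allLabels) : (p.toLabel l).1 = l := by
  simp [toLabel, h]

theorem toStack_val {p : Prog} {k : Stack} (h : k ∈ p.allStacks) : (p.toStack k).1 = k := by
  simp [toStack, h]

theorem update_toStack {p : Prog} {k : Stack} (h : k ∈ p.allStacks) (S : Stack → Word) (w : Word) :
    Function.update (fun k : {k // k ∈ p.allStacks} => S k.1) (p.toStack k) w =
      fun k' => Function.update S k w k'.1 := by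
  funext k'
  simp only [Function.update_apply, Subtype.ext_iff, toStack_val h]

theorem step_cfg (p : Prog) (O : Set Word) {l : List Prog} (hl : l ∈ p.allLabels) (s : Conf)
    (hq : queryLabel p.toLabel l = none) :
    p.machine.step O (p.cfg l s) = some (TM2.stepAux (stmt p.toStack p.toLabel l) none
      (fun k : {k // k ∈ p.allStacks} => s.stk k.1), s.log) := by
  have h1 : p.machine.query (p.toLabel l) = none := by
    change queryLabel p.toLabel (p.toLabel l).1 = none
    rwa [toLabel_val hl]
  have h2 : p.machine.m (p.toLabel l) = stmt p.toStack p.toLabel l := by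
    change stmt p.toStack p.toLabel (p.toLabel l).1 = _
    rw [toLabel_val hl]
  unfold cfg OracleMachine.step
  simp only [h1, FinTM2.step]
  rw [← h2]
  rfl

theorem stepAux_pushStmt {p : Prog} {ks : List Stack} (hks : ∀ k ∈ ks, k ∈ p.allStacks) (b : Bool)
    (q : TM2.Stmt (fun _ : {k // k ∈ p.allStacks} => Bool) p.allLabels (Option Bool)) (s : Conf) :
    TM2.stepAux (pushStmt p.toStack q ks) (some b) (fun k => s.stk k.1) =
      TM2.stepAux q (some b) (fun k => (s.pushAll b ks).stk k.1) ∧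
    (s.pushAll b ks).log = s.log := by
  induction ks generalizing s with
  | nil => exact ⟨rfl, rfl⟩
  | cons k ks ih =>
    have hk := hks k (by simp)
    obtain ⟨h1, h2⟩ := ih (fun k h => hks k (by simp [h])) (s.set k (b :: s.stk k))
    refine ⟨?_, h2⟩
    simp only [pushStmt, TM2.stepAux, toStack_val hk, Option.getD_some, Conf.pushAll]
    rw [update_toStack hk]
    exact h1

/-- Simulation, by induction on the run. The host program `P` is fixed while the continuation `l`
varies: the first part of a sequence and the body of a loop are entered with longer continuations.
-/
theorem runs_cfg (P : Prog) {O : Set Word} {p : Prog} {s s' : Conf} {t : ℕ}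
    (h : Runs O p s s' t) : ∀ {l : List Prog}, p.usedStacks ⊆ P.allStacks →
    p.labels l ⊆ P.allLabels → l ∈ P.allLabels →
    Nonempty (EvalsToInTime (P.machine.step O) (P.cfg (p :: l) s) (some (P.cfg l s')) t) := by
  induction h with
  | push k b s =>
    intro l hA hΛ hl
    have hk : k ∈ P.allStacks := hA (by simp [usedStacks])
    refine evalsToInTime_one ?_
    rw [step_cfg _ _ (hΛ (mem_labels _ _)) _ rfl]
    simp only [stmt, TM2.stepAux, toStack_val hk]
    rw [update_toStack hk]
    rfl
  | move k ks s =>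
    intro l hA hΛ hl
    have hk : k ∈ P.allStacks := hA (by simp [usedStacks])
    have hks : ∀ k ∈ ks, k ∈ P.allStacks := fun k h => hA (by simp [usedStacks, h])
    refine evalsToInTime_one ?_
    rw [step_cfg _ _ (hΛ (mem_labels _ _)) _ rfl]
    simp only [stmt, TM2.stepAux, toStack_val hk]
    rw [update_toStack hk, Conf.move]
    rcases hs : s.stk k with _ | ⟨b, w⟩
    · have : Function.update s.stk k [] = s.stk := by rw [← hs, Function.update_eq_self]
      simp only [List.head?_nil, List.tail_nil, Option.isSome_none, cond_false, this]
      rfl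
    · obtain ⟨h1, h2⟩ := stepAux_pushStmt hks b
        (.load (fun _ => none) (.goto fun _ => P.toLabel l)) (s.set k w)
      simp only [List.head?_cons, List.tail_cons, Option.isSome_some, cond_true]
      simp only [Conf.set] at h1 h2
      rw [h1]
      simp only [TM2.stepAux, cfg, Conf.set, h2]
      rfl
  | @seq p q s s' s'' t t' _ _ ih ih' =>
    intro l hA hΛ hl
    simp only [usedStacks, Finset.union_subset_iff] at hA
    have hΛ' := hΛ
    rw [labels, Set.insert_subset_iff, Set.union_subset_iff] at hΛ'
    refine evalsToInTime_mono (evalsToInTime_trans (evalsToInTime_one ?_) (evalsToInTime_trans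
      (ih hA.1 hΛ'.2.1 (hΛ'.2.2 (mem_labels _ _))) (ih' hA.2 hΛ'.2.2 hl))) (by omega)
    rw [step_cfg _ _ (hΛ (mem_labels _ _)) _ rfl]
    rfl
  | @branch_true k c p q s s' t hc _ ih =>
    intro l hA hΛ hl
    simp only [usedStacks, Finset.insert_subset_iff, Finset.union_subset_iff] at hA
    have hΛ' := hΛ
    rw [labels, Set.insert_subset_iff, Set.union_subset_iff] at hΛ'
    refine evalsToInTime_mono (evalsToInTime_trans (evalsToInTime_one ?_)
      (ih hA.2.1 hΛ'.2.1 hl)) (by omega)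
    rw [step_cfg _ _ (hΛ (mem_labels _ _)) _ rfl]
    simp only [stmt, TM2.stepAux, toStack_val hA.1, hc, cond_true]
    rfl
  | @branch_false k c p q s s' t hc _ ih =>
    intro l hA hΛ hl
    simp only [usedStacks, Finset.insert_subset_iff, Finset.union_subset_iff] at hA
    have hΛ' := hΛ
    rw [labels, Set.insert_subset_iff, Set.union_subset_iff] at hΛ'
    refine evalsToInTime_mono (evalsToInTime_trans (evalsToInTime_one ?_)
      (ih hA.2.2 hΛ'.2.2 hl)) (by omega)
    rw [step_cfg _ _ (hΛ (mem_labels _ _)) _ rfl]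
    simp only [stmt, TM2.stepAux, toStack_val hA.1, hc, cond_false]
    rfl
  | @loop_done k c p s hc =>
    intro l hA hΛ hl
    simp only [usedStacks, Finset.insert_subset_iff] at hA
    refine evalsToInTime_one ?_
    rw [step_cfg _ _ (hΛ (mem_labels _ _)) _ rfl]
    simp only [stmt, TM2.stepAux, toStack_val hA.1, hc, cond_false]
    rfl
  | @loop_step k c p s s' s'' t t' hc _ _ ih ih' =>
    intro l hA hΛ hl
    have hA' := hA
    simp only [usedStacks, Finset.insert_subset_iff] at hA'
    have hΛ' := hΛ
    rw [labels, Set.insert_subset_iff] at hΛ'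
    refine evalsToInTime_mono (evalsToInTime_trans (evalsToInTime_one ?_) (evalsToInTime_trans
      (ih hA'.2 hΛ'.2 hΛ'.1) (ih' hA hΛ hl))) (by omega)
    rw [step_cfg _ _ (hΛ (mem_labels _ _)) _ rfl]
    simp only [stmt, TM2.stepAux, toStack_val hA'.1, hc, cond_true]
    rfl
  | query s =>
    intro l hA hΛ hl
    have hq : Stack.qry ∈ P.allStacks := hA (by simp [usedStacks])
    have hr : Stack.res ∈ P.allStacks := hA (by simp [usedStacks])
    have hb : ∀ b, push .res b :: l ∈ P.allLabels := fun b => hΛ (by cases b <;> simp [labels])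
    -- The intermediate configuration has the answer in its label only; the next step writes it onto
    -- `res`.
    refine evalsToInTime_trans (s := 1) (t := 1)
      (b := P.cfg (push .res (@decide (s.stk .qry ∈ O) (Classical.propDecidable _)) :: l)
        ⟨Function.update s.stk .qry [], s.log ++ [s.stk .qry]⟩) ?_ ?_
    · refine evalsToInTime_one ?_
      have h1 : P.machine.query (P.toLabel (query :: l)) =
          some (P.toLabel (push .res true :: l), P.toLabel (push .res false :: l)) := by
        change queryLabel P.toLabel (P.toLabel (query :: l)).1 = _
        rw [toLabel_val (hΛ (mem_labels _ _))]
        rfl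
      have h2 : List.map P.machine.queryAlphabet (s.stk P.machine.kq.1) = s.stk .qry := by
        change List.map (Equiv.refl Bool) (s.stk (P.toStack .qry).1) = _
        rw [toStack_val hq]
        exact List.map_id _
      have h3 := update_toStack hq s.stk []
      unfold cfg OracleMachine.step
      simp only [h1, h2]
      refine congrArg some (Prod.ext ?_ rfl)
      change TM2.Cfg.mk _ _ _ = TM2.Cfg.mk _ _ _
      congr 1
      by_cases h : s.stk .qry ∈ O
      · rw [@decide_eq_true _ (Classical.propDecidable _) h]
        exact congrArg some (if_pos (show _ ∈ O by rw [h2]; exact h))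
      · rw [@decide_eq_false _ (Classical.propDecidable _) h]
        exact congrArg some (if_neg (show _ ∉ O by rw [h2]; exact h))
    · refine evalsToInTime_one ?_
      rw [step_cfg _ _ (hb _) _ rfl]
      simp only [stmt, TM2.stepAux, toStack_val hr]
      rw [update_toStack hr]
      rfl
  | mono _ hle ih =>
    intro l hA hΛ hl
    exact evalsToInTime_mono (ih hA hΛ hl) hle

/-- A terminating run of a program yields a run of its machine. -/
theorem machine_run {p : Prog} {O : Set Word} {x : Word} {b : Bool} {qs : List Word} {t : ℕ}
    (h : Runs O p ⟨Function.update (fun _ => []) .inp x, []⟩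
      ⟨Function.update (fun _ => []) .res [b], qs⟩ t) : p.machine.Run O x b qs (t + 1) := by
  have h0 : [] ∈ p.allLabels := by simp [allLabels]
  have hi : Stack.inp ∈ p.allStacks := by simp [allStacks]
  have hr : Stack.res ∈ p.allStacks := by simp [allStacks]
  have h1 := runs_cfg p h (l := []) (by intro k; simp +contextual [allStacks])
    (Set.subset_insert _ _) h0
  -- One more step executes the `halt` at the empty continuation.
  have h2 := evalsToInTime_trans h1 (evalsToInTime_one rfl)
  rw [step_cfg _ _ h0 _ rfl] at h2
  have e1 : (initList p.machine.toFinTM2 (x.map p.machine.inputAlphabet.symm), []) =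
      p.cfg [p] ⟨Function.update (fun _ => []) .inp x, []⟩ := by
    refine Prod.ext ?_ rfl
    change TM2.Cfg.mk _ _ _ = TM2.Cfg.mk _ _ _
    congr 1
    funext k
    by_cases hk : k = p.toStack .inp
    · subst hk
      refine Eq.trans ?_ (Eq.trans (congrArg (Function.update (fun _ => []) .inp x) (toStack_val hi))
        (Function.update_self _ _ _)).symm
      refine (dif_pos rfl).trans ?_
      exact List.map_id _
    · have : k.1 ≠ .inp := fun hk' => hk (Subtype.ext (hk'.trans (toStack_val hi).symm))
      exact (dif_neg hk).trans (Function.update_of_ne this _ (fun _ => ([] : Word))).symm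
  have e2 : (haltList p.machine.toFinTM2 [p.machine.outputAlphabet.symm b], qs) =
      (TM2.stepAux (stmt p.toStack p.toLabel []) none
        (fun k : {k // k ∈ p.allStacks} =>
          (Function.update (fun _ => []) .res [b] : Stack → Word) k.1), qs) := by
    refine Prod.ext ?_ rfl
    change TM2.Cfg.mk _ _ _ = TM2.Cfg.mk _ _ _
    congr 1
    funext k
    by_cases hk : k = p.toStack .res
    · subst hk
      refine Eq.trans ?_ (Eq.trans (congrArg (Function.update (fun _ => []) .res [b]) (toStack_val hr))
        (Function.update_self _ _ _)).symm
      exact dif_pos rfl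
    · have : k.1 ≠ .res := fun hk' => hk (Subtype.ext (hk'.trans (toStack_val hr).symm))
      exact (dif_neg hk).trans (Function.update_of_ne this _ (fun _ => ([] : Word))).symm
  unfold OracleMachine.Run
  rw [e1, e2]
  exact h2

end Prog

/-! ### Basic programs -/

namespace Conf

@[simp] theorem set_stk (s : Conf) (k : Stack) (w : Word) (k' : Stack) :
    (s.set k w).stk k' = if k' = k then w else s.stk k' := Function.update_apply _ _ _ _

@[simp] theorem set_log (s : Conf) (k : Stack) (w : Word) : (s.set k w).log = s.log := rfl

theorem ext_stk {s s' : Conf} (h : ∀ k, s.stk k = s'.stk k) (h' : s.log = s'.log) : s = s' :=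
  Conf.ext (funext h) h'

theorem move_nil {s : Conf} {k : Stack} (ks : List Stack) (h : s.stk k = []) : s.move k ks = s := by
  simp [move, h]

theorem move_cons {s : Conf} {k : Stack} (ks : List Stack) {b : Bool} {w : Word}
    (h : s.stk k = b :: w) : s.move k ks = pushAll b ks (s.set k w) := by
  simp [move, h]

end Conf

theorem Runs.congr_conf {O : Set Word} {p : Prog} {s s₁ s₂ : Conf} {t : ℕ} (h : Runs O p s s₁ t)
    (e : s₁ = s₂) : Runs O p s s₂ t := e ▸ h

theorem Runs.congr_conf' {O : Set Word} {p : Prog} {s s₁ s₂ : Conf} {t : ℕ} (h : Runs O p s₁ s t)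
    (e : s₁ = s₂) : Runs O p s₂ s t := e ▸ h

/-- The function `f` is the loop invariant in explicit form: `f j` is the configuration after `j`
rounds. -/
theorem runs_loop {O : Set Word} {k : Stack} {c : Option Bool → Bool} {p : Prog} {t : ℕ} (n : ℕ)
    (f : ℕ → Conf) (hc : ∀ j < n, c ((f j).stk k).head? = true)
    (hp : ∀ j < n, Runs O p (f j) (f (j + 1)) t) (hn : c ((f n).stk k).head? = false) :
    Runs O (.loop k c p) (f 0) (f n) (n * (t + 1) + 1) := by
  induction n generalizing f with
  | zero => simpa using Runs.loop_done hn
  | succ n ih =>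
    refine (Runs.loop_step (hc 0 (by omega)) (hp 0 (by omega))
      (ih (fun j => f (j + 1)) (fun j hj => hc _ (by omega)) (fun j hj => hp _ (by omega))
        hn)).mono ?_
    apply le_of_eq; ring

namespace Prog

/-- Do nothing. -/
def skip : Prog := move .tmp []

/-- Move the whole stack `k` to other stacks, which reverses the order. -/
def drain (k : Stack) (ks : List Stack) : Prog := loop k Option.isSome (move k ks)

/-- Copy the reversed stack `k` to `k'`. -/
def copy (k k' : Stack) : Prog := seq (drain k [.tmp, k']) (drain .tmp [k])

end Prog

variable {O : Set Word}

/-- Moving from an empty stack changes nothing, and `tmp` is empty whenever `skip` is used. -/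
theorem runs_skip {s : Conf} (h : s.stk .tmp = []) : Runs O .skip s s 1 := by
  have h1 := Runs.move (O := O) .tmp [] s
  rwa [Conf.move_nil [] h] at h1

theorem runs_drain_nil (k : Stack) (s : Conf) :
    Runs O (.drain k []) s (s.set k []) (2 * (s.stk k).length + 1) := by
  generalize hw : s.stk k = w
  induction w generalizing s with
  | nil =>
    refine (Runs.loop_done (by simp [hw])).congr_conf ?_
    refine Conf.ext_stk (fun k' => ?_) rfl
    simp only [Conf.set_stk]
    split_ifs <;> simp_all
  | cons b w ih =>
    have h1 := Runs.move (O := O) k [] s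
    rw [Conf.move_cons _ hw] at h1
    have h2 := ih (s.set k w) (by simp)
    rw [show (s.set k w).set k [] = s.set k [] from
      Conf.ext_stk (by intro k'; simp +contextual) rfl] at h2
    exact (Runs.loop_step (by simp [hw]) h1 h2).mono (by simp; omega)

theorem runs_drain_one {k k₁ : Stack} (h : k ≠ k₁) (s : Conf) :
    Runs O (.drain k [k₁]) s ((s.set k₁ ((s.stk k).reverse ++ s.stk k₁)).set k [])
      (2 * (s.stk k).length + 1) := by
  generalize hw : s.stk k = w
  induction w generalizing s with
  | nil =>
    refine (Runs.loop_done (by simp [hw])).congr_conf ?_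
    refine Conf.ext_stk (fun k' => ?_) rfl
    simp only [Conf.set_stk]
    split_ifs <;> simp_all
  | cons b w ih =>
    have h1 := Runs.move (O := O) k [k₁] s
    rw [Conf.move_cons _ hw] at h1
    have h2 := ih (Conf.pushAll b [k₁] (s.set k w)) (by simp [Conf.pushAll, h])
    refine ((Runs.loop_step (by simp [hw]) h1 h2).mono
      (t' := 2 * (b :: w).length + 1) (by simp; omega)).congr_conf ?_
    refine Conf.ext_stk (fun k' => ?_) rfl
    simp only [Conf.pushAll, Conf.set_stk]
    split_ifs <;> simp_all

theorem runs_drain_two {k k₁ k₂ : Stack} (h₁ : k ≠ k₁) (h₂ : k ≠ k₂) (h₁₂ : k₁ ≠ k₂) (s : Conf) :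
    Runs O (.drain k [k₁, k₂]) s (((s.set k₁ ((s.stk k).reverse ++ s.stk k₁)).set k₂
      ((s.stk k).reverse ++ s.stk k₂)).set k []) (2 * (s.stk k).length + 1) := by
  generalize hw : s.stk k = w
  induction w generalizing s with
  | nil =>
    refine (Runs.loop_done (by simp [hw])).congr_conf ?_
    refine Conf.ext_stk (fun k' => ?_) rfl
    simp only [Conf.set_stk]
    split_ifs <;> simp_all
  | cons b w ih =>
    have h1 := Runs.move (O := O) k [k₁, k₂] s
    rw [Conf.move_cons _ hw] at h1
    have h2 := ih (Conf.pushAll b [k₁, k₂] (s.set k w)) (by simp [Conf.pushAll, h₁, h₂])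
    refine ((Runs.loop_step (by simp [hw]) h1 h2).mono
      (t' := 2 * (b :: w).length + 1) (by simp; omega)).congr_conf ?_
    refine Conf.ext_stk (fun k' => ?_) rfl
    simp only [Conf.pushAll, Conf.set_stk]
    split_ifs <;> simp_all

/-- The first drain reverses `k` into both `tmp` and `k'`; draining `tmp` back reverses again and so
restores `k`. -/
theorem runs_copy {k k' : Stack} (h : k ≠ k') (hk : k ≠ .tmp) (hk' : k' ≠ .tmp) {s : Conf}
    (ht : s.stk .tmp = []) :
    Runs O (.copy k k') s (s.set k' ((s.stk k).reverse ++ s.stk k'))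
      (4 * (s.stk k).length + 3) := by
  refine ((Runs.seq (runs_drain_two hk h hk'.symm s) (runs_drain_one hk.symm _)).mono
    ?_).congr_conf ?_
  · simp [ht, hk.symm, hk'.symm]; omega
  · refine Conf.ext_stk (fun i => ?_) rfl
    simp only [Conf.set_stk]
    split_ifs <;> simp_all

/-! ### Positions -/

/-- The quantities from which the positions in the input are computed. -/
inductive Counter
  | dim
  | var (i : ℕ)
  | cov (i : ℕ)

/-- The stack that stores a quantity in unary. -/
def Counter.stack : Counter → Stack
  | dim => .dim
  | var i => .var i
  | cov i => .cov i

/-- The value of a sum of products of quantities. -/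
def posVal (v : Counter → ℕ) (q : List (List Counter)) : ℕ := (q.map fun m => (m.map v).prod).sum

namespace Prog

/-- Add a product of quantities to the stack `pos`. -/
def addProd : ℕ → List Counter → Prog
  | _, [] => push .pos true
  | d, c :: m => seq (copy c.stack (.cnt d))
      (loop (.cnt d) Option.isSome (seq (move (.cnt d) []) (addProd (d + 1) m)))

/-- Add a sum of products of quantities to the stack `pos`. -/
def addPos : List (List Counter) → Prog
  | [] => skip
  | m :: q => seq (addProd 0 m) (addPos q)

/-- Go to a position of the input. -/
def walk (q : List (List Counter)) : Prog :=
  seq (addPos q) (loop .pos Option.isSome (seq (move .pos []) (move .inp [.rev])))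

/-- Go back to the beginning of the input. -/
def back : Prog := drain .rev [.inp]

end Prog

-- A product is computed by nested loops, one for each factor, and the innermost level pushes one
-- mark, the empty product. The loop at depth `d` counts on `cnt d`, which is why all counters from
-- `d` on must be empty.
open Polynomial in
theorem runs_addProd (m : List Counter) : ∃ p : Polynomial ℕ, ∀ (O : Set Word) (d : ℕ) (s : Conf)
    (B : ℕ), (∀ c : Counter, (s.stk c.stack).length ≤ B) → s.stk .tmp = [] →
    (∀ e, d ≤ e → s.stk (.cnt e) = []) →
    Runs O (.addProd d m) s (s.set .pos (List.replicate
      (m.map fun c => (s.stk c.stack).length).prod true ++ s.stk .pos)) (p.eval B) := by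
  induction m with
  | nil => exact ⟨1, fun O d s B _ _ _ => by
    simpa [Prog.addProd] using Runs.push (O := O) .pos true s⟩
  | cons c m ih =>
    obtain ⟨p, hp⟩ := ih
    refine ⟨(4 * X + 3) + (X * ((1 + p + 1) + 1) + 1) + 1, fun O d s B hB ht hd => ?_⟩
    have hc : ∀ c : Counter, c.stack ≠ .tmp ∧ (∀ e, c.stack ≠ .cnt e) ∧ c.stack ≠ .pos := by
      intro c; cases c <;> simp [Counter.stack]
    have h1 := runs_copy (O := O) (k := c.stack) (k' := .cnt d) ((hc c).2.1 d) (hc c).1 (by simp) ht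
    set w := s.stk c.stack with hw
    set a := (m.map fun c => (s.stk c.stack).length).prod with ha
    -- Each round consumes one letter of the counter and adds `a`, the product of the remaining
    -- factors.
    let f : ℕ → Conf := fun j => (s.set (.cnt d) (w.reverse.drop j)).set .pos
      (List.replicate (j * a) true ++ s.stk .pos)
    have h2 := runs_loop (O := O) (k := .cnt d) (c := Option.isSome)
      (p := .seq (.move (.cnt d) []) (.addProd (d + 1) m)) (t := 1 + p.eval B + 1) w.length f
      (fun j hj => by simp [f, hj]) (fun j hj => ?_) (by simp [f])
    · refine ((h1.congr_conf ?_).seq (h2.congr_conf ?_)).mono ?_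
      · refine Conf.ext_stk (fun k => ?_) rfl
        simp only [f, Conf.set_stk, hd d le_rfl]
        split_ifs <;> simp_all
      · refine Conf.ext_stk (fun k => ?_) rfl
        simp only [f, Conf.set_stk, List.map_cons, List.prod_cons, ← hw, ← ha]
        split_ifs <;> simp_all
      · simp only [eval_add, eval_mul, eval_X, eval_one, eval_ofNat]
        have := hB c
        gcongr
    · have hj' : j < w.reverse.length := by simpa using hj
      have e1 : (f j).stk (.cnt d) = w.reverse[j] :: w.reverse.drop (j + 1) := by
        simp only [f, Conf.set_stk, reduceCtorEq, if_false, if_true]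
        exact List.drop_eq_getElem_cons hj'
      have h3 := Runs.move (O := O) (.cnt d) [] (f j)
      rw [Conf.move_cons _ e1] at h3
      refine (h3.seq (hp O (d + 1) _ B ?_ ?_ ?_)).congr_conf ?_
      · intro c
        have := hc c
        simpa [Conf.pushAll, f, this] using hB c
      · simp [Conf.pushAll, f, ht]
      · intro e he
        have : e ≠ d := by omega
        simpa [Conf.pushAll, f, this] using hd e (by omega)
      · refine Conf.ext_stk (fun k => ?_) rfl
        have : (m.map fun c => ((Conf.pushAll w.reverse[j] [] ((f j).set (.cnt d)
            (w.reverse.drop (j + 1)))).stk c.stack).length) =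
            m.map fun c => (s.stk c.stack).length := by
          refine List.map_congr_left fun c _ => ?_
          simp [Conf.pushAll, f, hc c]
        rw [this, ← ha]
        simp only [Conf.pushAll, f, Conf.set_stk]
        split_ifs <;> simp_all
        rw [← List.append_assoc, List.replicate_append_replicate]
        congr 2; ring

open Polynomial in
theorem runs_addPos (q : List (List Counter)) : ∃ p : Polynomial ℕ, ∀ (O : Set Word) (s : Conf)
    (B : ℕ), (∀ c : Counter, (s.stk c.stack).length ≤ B) → s.stk .tmp = [] →
    (∀ e, s.stk (.cnt e) = []) →
    Runs O (.addPos q) s (s.set .pos (List.replicate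
      (posVal (fun c => (s.stk c.stack).length) q) true ++ s.stk .pos)) (p.eval B) := by
  induction q with
  | nil =>
    refine ⟨1, fun O s B _ ht _ => ((runs_skip ht).congr_conf ?_).mono (by simp)⟩
    refine Conf.ext_stk (fun k => ?_) rfl
    simp +contextual [posVal]
  | cons m q ih =>
    obtain ⟨p, hp⟩ := runs_addProd m
    obtain ⟨p', hp'⟩ := ih
    refine ⟨p + p' + 1, fun O s B hB ht hc => ?_⟩
    have hpos : ∀ c : Counter, c.stack ≠ .pos := by intro c; cases c <;> simp [Counter.stack]
    refine (((hp O 0 s B hB ht fun e _ => hc e).seq (hp' O _ B (fun c => by simpa [hpos c] using hB c)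
      (by simpa using ht) (by simpa using hc))).congr_conf ?_).mono (by simp)
    refine Conf.ext_stk (fun k => ?_) rfl
    simp only [Conf.set_stk, hpos, if_false, if_true]
    split_ifs
    · rw [← List.append_assoc, List.replicate_append_replicate]
      congr 2
      simp [posVal, add_comm]
    · rfl

open Polynomial in
theorem exists_posVal_le (q : List (List Counter)) : ∃ p : Polynomial ℕ, ∀ (v : Counter → ℕ)
    (B : ℕ), (∀ c, v c ≤ B) → posVal v q ≤ p.eval B := by
  have h : ∀ m : List Counter, ∀ (v : Counter → ℕ) (B : ℕ), (∀ c, v c ≤ B) →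
      (m.map v).prod ≤ B ^ m.length := by
    intro m v B hB
    induction m with
    | nil => simp
    | cons c m ih =>
      simp only [List.map_cons, List.prod_cons, List.length_cons, pow_succ']
      exact Nat.mul_le_mul (hB c) ih
  induction q with
  | nil => exact ⟨0, fun v B _ => by simp [posVal]⟩
  | cons m q ih =>
    obtain ⟨p, hp⟩ := ih
    refine ⟨X ^ m.length + p, fun v B hB => ?_⟩
    have h1 := hp v B hB
    have h2 := h m v B hB
    simp only [posVal, List.map_cons, List.sum_cons, eval_add, eval_pow, eval_X] at h1 ⊢
    omega

-- The walk may run past the end of the input: moving from the empty `inp` does nothing, in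
-- agreement with the truncation in `drop` and `take`.
open Polynomial in
theorem runs_walk (q : List (List Counter)) : ∃ p : Polynomial ℕ, ∀ (O : Set Word) (s : Conf)
    (B : ℕ), (∀ c : Counter, (s.stk c.stack).length ≤ B) → s.stk .tmp = [] →
    (∀ e, s.stk (.cnt e) = []) → s.stk .pos = [] → s.stk .rev = [] →
    Runs O (.walk q) s ((s.set .inp ((s.stk .inp).drop
      (posVal (fun c => (s.stk c.stack).length) q))).set .rev ((s.stk .inp).take
      (posVal (fun c => (s.stk c.stack).length) q)).reverse) (p.eval B) := by
  obtain ⟨p, hp⟩ := runs_addPos q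
  obtain ⟨p', hp'⟩ := exists_posVal_le q
  refine ⟨p + (p' * ((1 + 1 + 1) + 1) + 1) + 1, fun O s B hB ht hc hpos hrev => ?_⟩
  have h1 := hp O s B hB ht hc
  have hle := hp' _ B hB
  set v := posVal (fun c => (s.stk c.stack).length) q with hv
  set w := s.stk .inp with hw
  let f : ℕ → Conf := fun j => ((s.set .pos (List.replicate (v - j) true)).set .inp
    (w.drop j)).set .rev (w.take j).reverse
  have h2 := runs_loop (O := O) (k := .pos) (c := Option.isSome)
    (p := .seq (.move .pos []) (.move .inp [.rev])) (t := 1 + 1 + 1) v f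
    (fun j hj => by simp [f, List.head?_replicate]; omega) (fun j hj => ?_) (by simp [f])
  · refine ((h1.congr_conf ?_).seq (h2.congr_conf ?_)).mono ?_
    · refine Conf.ext_stk (fun k => ?_) rfl
      simp only [f, Conf.set_stk, hpos]
      split_ifs <;> simp_all
    · refine Conf.ext_stk (fun k => ?_) rfl
      simp only [f, Conf.set_stk]
      split_ifs <;> simp_all
    · simp only [eval_add, eval_mul, eval_one]
      gcongr
  · have e1 : (f j).stk .pos = true :: List.replicate (v - (j + 1)) true := by
      simp only [f, Conf.set_stk, reduceCtorEq, if_false, if_true]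
      rw [← List.replicate_succ]
      congr 1; omega
    have h3 := Runs.move (O := O) .pos [] (f j)
    rw [Conf.move_cons _ e1] at h3
    refine (h3.seq (Runs.move .inp [.rev] _)).congr_conf ?_
    by_cases hj' : j < w.length
    · rw [Conf.move_cons (b := w[j]) (w := w.drop (j + 1)) _ (by simp [Conf.pushAll, f])]
      have h4 : (w.take (j + 1)).reverse = w[j] :: (w.take j).reverse := by
        rw [List.take_succ_eq_append_getElem hj']
        simp
      refine Conf.ext_stk (fun k => ?_) rfl
      simp only [Conf.pushAll, f, Conf.set_stk, h4]
      split_ifs <;> simp_all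
    -- The head is already past the last letter and stays there.
    · have h4 : w.drop j = [] := List.drop_eq_nil_of_le (by omega)
      have h5 : w.drop (j + 1) = [] := List.drop_eq_nil_of_le (by omega)
      rw [Conf.move_nil _ (by simp [Conf.pushAll, f, h4])]
      refine Conf.ext_stk (fun k => ?_) rfl
      have h6 : w.take j = w := List.take_of_length_le (by omega)
      have h7 : w.take (j + 1) = w := List.take_of_length_le (by omega)
      simp only [Conf.pushAll, f, Conf.set_stk, h4, h5, h6, h7]
      split_ifs <;> simp_all

/-! ### Programs that evaluate formulas -/

/-- The standard configuration: the input is `x`, the domain has size `n`, the variables have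
values `a`, the differences of `n` and these values are `a'`, and the truth values `r` have been
computed. -/
def Conf.std (x : Word) (n : ℕ) (a a' : ℕ → ℕ) (r : List Bool) (qs : List Word) : Conf where
  stk
    | .inp => x
    | .dim => List.replicate n true
    | .res => r
    | .var i => List.replicate (a i) true
    | .cov i => List.replicate (a' i) true
    | _ => []
  log := qs

/-- The values of the quantities. -/
def Counter.val (n : ℕ) (a a' : ℕ → ℕ) : Counter → ℕ
  | dim => n
  | var i => a i
  | cov i => a' i

theorem Conf.std_counter (x : Word) (n : ℕ) (a a' : ℕ → ℕ) (r : List Bool) (qs : List Word)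
    (c : Counter) : ((Conf.std x n a a' r qs).stk c.stack).length = c.val n a a' := by
  cases c <;> simp [std, Counter.val, Counter.stack]

/-- Simple formulas about an input `x`, with variables for elements of `{0, …, n-1}`, which can also
ask the oracle. -/
inductive Fml : ℕ → Type
  /-- a constant -/
  | const {l} (b : Bool) : Fml l
  /-- a test of the letter of the input at some position -/
  | look {l} (q : List (List Counter)) (c : Option Bool → Bool) : Fml l
  /-- if the input has a zero at some position then ask the oracle about the word that has a one
  instead -/
  | ask {l} (q : List (List Counter)) : Fml l
  | ite {l} (F G H : Fml l) : Fml l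
  /-- conjunction, where both parts are always evaluated -/
  | and {l} (F G : Fml l) : Fml l
  /-- universal quantification over `{0, …, n-1}` -/
  | all {l} (F : Fml (l + 1)) : Fml l

namespace Fml

open Classical in
/-- The truth value of a formula. -/
noncomputable def val (O : Set Word) (x : Word) (n : ℕ) :
    ∀ {l}, Fml l → (ℕ → ℕ) → (ℕ → ℕ) → Bool
  | _, const b, _, _ => b
  | _, look q c, a, a' => c x[posVal (Counter.val n a a') q]?
  | _, ask q, a, a' => x[posVal (Counter.val n a a') q]? = some false ∧
      x.set (posVal (Counter.val n a a') q) true ∈ O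
  | _, ite F G H, a, a' => bif F.val O x n a a' then G.val O x n a a' else H.val O x n a a'
  | _, and F G, a, a' => F.val O x n a a' && G.val O x n a a'
  | l, all F, a, a' => (List.range n).all fun j =>
      F.val O x n (Function.update a l j) (Function.update a' l (n - j))

/-- The words about which the oracle is asked during the evaluation of a formula. -/
noncomputable def asks (O : Set Word) (x : Word) (n : ℕ) :
    ∀ {l}, Fml l → (ℕ → ℕ) → (ℕ → ℕ) → List Word
  | _, const _, _, _ => []
  | _, look _ _, _, _ => []
  | _, ask q, a, a' => if x[posVal (Counter.val n a a') q]? = some false then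
      [x.set (posVal (Counter.val n a a') q) true] else []
  | _, ite F G H, a, a' => F.asks O x n a a' ++
      bif F.val O x n a a' then G.asks O x n a a' else H.asks O x n a a'
  | _, and F G, a, a' => F.asks O x n a a' ++ G.asks O x n a a'
  | l, all F, a, a' => (List.range n).flatMap fun j =>
      F.asks O x n (Function.update a l j) (Function.update a' l (n - j))

end Fml

namespace Prog

/-- Replace the first two truth values by their conjunction. -/
def conj : Prog :=
  branch .res (· == some true) (move .res []) (seq (move .res []) (seq (move .res [])
    (push .res false)))

/-- Test the letter at a position of the input. -/
def look (q : List (List Counter)) (c : Option Bool → Bool) : Prog :=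
  seq (walk q) (seq (branch .inp c (push .res true) (push .res false)) back)

/-- Replace the letter at a position of the input. -/
def setBit (q : List (List Counter)) (b : Bool) : Prog :=
  seq (walk q) (seq (move .inp []) (seq (push .inp b) back))

/-- Ask the oracle about the word with a one at a position of the input. -/
def askAt (q : List (List Counter)) : Prog :=
  seq (setBit q true) (seq (drain .inp [.rev]) (seq (drain .rev [.inp, .qry])
    (seq query (setBit q false))))

end Prog

/-- The program that evaluates a formula. -/
def Fml.prog : ∀ {l}, Fml l → Prog
  | _, const b => .push .res b
  | _, look q c => .look q c
  | _, ask q => .seq (.look q (· == some false)) (.branch .res (· == some true)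
      (.seq (.move .res []) (.askAt q)) .skip)
  | _, ite F G H => .seq F.prog (.branch .res (· == some true) (.seq (.move .res []) G.prog)
      (.seq (.move .res []) H.prog))
  | _, and F G => .seq F.prog (.seq G.prog .conj)
  -- While `var l` counts up from `0`, `cov l` counts down from `n` and serves as the loop counter,
  -- so they hold `j` and `n - j` in round `j`. The result is accumulated on `res`, starting with
  -- the empty conjunction.
  | l, all F => .seq (.push .res true) (.seq (.copy .dim (.cov l)) (.seq (.loop (.cov l)
      Option.isSome (.seq F.prog (.seq .conj (.seq (.move (.cov l) []) (.push (.var l) true)))))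
      (.drain (.var l) [])))

section

variable {x : Word} {n : ℕ} {a a' : ℕ → ℕ} {r : List Bool} {qs : List Word}

theorem Conf.std_set_res (r' : List Bool) :
    (Conf.std x n a a' r qs).set .res r' = Conf.std x n a a' r' qs := by
  refine Conf.ext_stk (fun k => ?_) rfl
  cases k <;> simp [Conf.std]

theorem Conf.std_set_inp (x' : Word) :
    (Conf.std x n a a' r qs).set .inp x' = Conf.std x' n a a' r qs := by
  refine Conf.ext_stk (fun k => ?_) rfl
  cases k <;> simp [Conf.std]

theorem Conf.std_set_var (i m : ℕ) : (Conf.std x n a a' r qs).set (.var i)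
    (List.replicate m true) = Conf.std x n (Function.update a i m) a' r qs := by
  refine Conf.ext_stk (fun k => ?_) rfl
  cases k <;> simp [Conf.std, Function.update_apply, apply_ite (List.replicate · true)]

theorem Conf.std_set_cov (i m : ℕ) : (Conf.std x n a a' r qs).set (.cov i)
    (List.replicate m true) = Conf.std x n a (Function.update a' i m) r qs := by
  refine Conf.ext_stk (fun k => ?_) rfl
  cases k <;> simp [Conf.std, Function.update_apply, apply_ite (List.replicate · true)]

theorem runs_push_res (b : Bool) :
    Runs O (.push .res b) (.std x n a a' r qs) (.std x n a a' (b :: r) qs) 1 := by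
  rw [← Conf.std_set_res (r := r) (b :: r)]
  exact Runs.push _ _ _

theorem runs_pop_res (b : Bool) :
    Runs O (.move .res []) (.std x n a a' (b :: r) qs) (.std x n a a' r qs) 1 := by
  rw [← Conf.std_set_res (r := b :: r) r]
  exact (Runs.move _ _ _).congr_conf (Conf.move_cons (b := b) _ rfl)

theorem runs_conj (b b' : Bool) :
    Runs O .conj (.std x n a a' (b' :: b :: r) qs) (.std x n a a' ((b && b') :: r) qs) 6 := by
  cases b'
  · refine (Runs.branch_false (by simp [Conf.std]) ((runs_pop_res _).seq
      ((runs_pop_res _).seq (runs_push_res _)))).mono (by norm_num) |>.congr_conf (by simp)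
  · exact (Runs.branch_true (by simp [Conf.std]) (runs_pop_res _)).mono (by norm_num)
      |>.congr_conf (by simp)

end

section

variable (q : List (List Counter))

open Polynomial in
theorem runs_walk_std : ∃ p : Polynomial ℕ, ∀ (O : Set Word) (x : Word) (n : ℕ)
    (a a' : ℕ → ℕ) (r : List Bool) (qs : List Word) (B : ℕ), (∀ c : Counter, c.val n a a' ≤ B) →
    Runs O (.walk q) (.std x n a a' r qs)
      ((Conf.std (x.drop (posVal (Counter.val n a a') q)) n a a' r qs).set .rev
        (x.take (posVal (Counter.val n a a') q)).reverse) (p.eval B) := by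
  obtain ⟨p, hp⟩ := runs_walk q
  refine ⟨p, fun O x n a a' r qs B hB => ?_⟩
  have e : (fun c : Counter => ((Conf.std x n a a' r qs).stk c.stack).length) =
      Counter.val n a a' := funext fun c => Conf.std_counter ..
  have h1 := hp O (.std x n a a' r qs) B (fun c => by rw [Conf.std_counter]; exact hB c) rfl
    (fun _ => rfl) rfl rfl
  rw [e] at h1
  exact h1.congr_conf (by rw [Conf.std_set_inp]; rfl)

theorem runs_back (O : Set Word) (x y : Word) (n : ℕ) (a a' : ℕ → ℕ) (r : List Bool)
    (qs : List Word) : Runs O .back ((Conf.std y n a a' r qs).set .rev x)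
      (.std (x.reverse ++ y) n a a' r qs) (2 * x.length + 1) := by
  refine ((runs_drain_one (by simp) _).congr_conf ?_).mono ?_
  · refine Conf.ext_stk (fun k => ?_) rfl
    cases k <;> simp [Conf.std]
  · simp

open Polynomial in
theorem runs_look (c : Option Bool → Bool) : ∃ p : Polynomial ℕ, ∀ (O : Set Word) (x : Word)
    (n : ℕ) (a a' : ℕ → ℕ) (r : List Bool) (qs : List Word) (B : ℕ),
    (∀ c : Counter, c.val n a a' ≤ B) → x.length ≤ B →
    Runs O (.look q c) (.std x n a a' r qs)
      (.std x n a a' (c x[posVal (Counter.val n a a') q]? :: r) qs) (p.eval B) := by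
  obtain ⟨p, hp⟩ := runs_walk_std q
  refine ⟨p + ((1 + 1) + (2 * X + 1) + 1) + 1, fun O x n a a' r qs B hB hx => ?_⟩
  have h1 := hp O x n a a' r qs B hB
  set v := posVal (Counter.val n a a') q
  have h2 : Runs O (.branch .inp c (.push .res true) (.push .res false))
      ((Conf.std (x.drop v) n a a' r qs).set .rev (x.take v).reverse)
      ((Conf.std (x.drop v) n a a' (c x[v]? :: r) qs).set .rev (x.take v).reverse) (1 + 1) := by
    have e : ∀ b : Bool, ((Conf.std (x.drop v) n a a' r qs).set .rev (x.take v).reverse).set .res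
        (b :: ((Conf.std (x.drop v) n a a' r qs).set .rev (x.take v).reverse).stk .res) =
        (Conf.std (x.drop v) n a a' (b :: r) qs).set .rev (x.take v).reverse := by
      intro b
      refine Conf.ext_stk (fun k => ?_) rfl
      cases k <;> simp [Conf.std]
    have ei : (((Conf.std (x.drop v) n a a' r qs).set .rev (x.take v).reverse).stk .inp).head? =
        x[v]? := by simp [Conf.std]
    cases hc : c x[v]?
    · exact Runs.branch_false (by rw [ei]; exact hc) ((Runs.push _ _ _).congr_conf (e false))
    · exact Runs.branch_true (by rw [ei]; exact hc) ((Runs.push _ _ _).congr_conf (e true))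
  refine ((h1.seq (h2.seq (runs_back O _ _ n a a' _ qs))).congr_conf (by simp)).mono ?_
  simp only [eval_add, eval_mul, eval_one, eval_X, eval_ofNat, List.length_reverse,
    List.length_take]
  gcongr
  omega

-- The position has to lie inside the word; past the end the program would append a letter.
open Polynomial in
theorem runs_setBit (b : Bool) : ∃ p : Polynomial ℕ, ∀ (O : Set Word) (x : Word) (n : ℕ)
    (a a' : ℕ → ℕ) (r : List Bool) (qs : List Word) (B : ℕ),
    (∀ c : Counter, c.val n a a' ≤ B) → x.length ≤ B →
    posVal (Counter.val n a a') q < x.length →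
    Runs O (.setBit q b) (.std x n a a' r qs)
      (.std (x.set (posVal (Counter.val n a a') q) b) n a a' r qs) (p.eval B) := by
  obtain ⟨p, hp⟩ := runs_walk_std q
  refine ⟨p + (1 + (1 + (2 * X + 1) + 1) + 1) + 1, fun O x n a a' r qs B hB hx hv => ?_⟩
  have h1 := hp O x n a a' r qs B hB
  set v := posVal (Counter.val n a a') q
  have h2 := Runs.move (O := O) .inp [] ((Conf.std (x.drop v) n a a' r qs).set .rev
    (x.take v).reverse)
  rw [Conf.move_cons (b := x[v]) (w := x.drop (v + 1)) _
    (by simp [Conf.std])] at h2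
  have h3 := (Runs.push (O := O) .inp b _).congr_conf
    (s₁ := (Conf.pushAll x[v] [] (((Conf.std (x.drop v) n a a' r qs).set .rev
      (x.take v).reverse).set .inp (x.drop (v + 1)))).set .inp (b :: x.drop (v + 1)))
    (s₂ := (Conf.std (b :: x.drop (v + 1)) n a a' r qs).set .rev (x.take v).reverse) (by
      refine Conf.ext_stk (fun k => ?_) rfl
      cases k <;> simp [Conf.std, Conf.pushAll])
  refine ((h1.seq (h2.seq (Runs.seq (by simp only [Conf.pushAll] at h3 ⊢; exact h3)
    (runs_back O _ _ n a a' r qs)))).congr_conf ?_).mono ?_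
  · rw [List.reverse_reverse, List.set_eq_take_append_cons_drop, if_pos hv]
  · simp only [eval_add, eval_mul, eval_one, eval_X, eval_ofNat, List.length_reverse,
      List.length_take]
    gcongr
    omega

-- The letter is set to one, the whole word is copied to `qry` by way of `rev`, and after the call
-- the letter is set back. Draining twice restores the order of the letters.
open Classical Polynomial in
theorem runs_askAt : ∃ p : Polynomial ℕ, ∀ (O : Set Word) (x : Word) (n : ℕ)
    (a a' : ℕ → ℕ) (r : List Bool) (qs : List Word) (B : ℕ),
    (∀ c : Counter, c.val n a a' ≤ B) → x.length ≤ B →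
    x[posVal (Counter.val n a a') q]? = some false →
    Runs O (.askAt q) (.std x n a a' r qs)
      (.std x n a a' (decide (x.set (posVal (Counter.val n a a') q) true ∈ O) :: r)
        (qs ++ [x.set (posVal (Counter.val n a a') q) true])) (p.eval B) := by
  obtain ⟨p, hp⟩ := runs_setBit q true
  obtain ⟨p', hp'⟩ := runs_setBit q false
  refine ⟨p + ((2 * X + 1) + ((2 * X + 1) + (2 + p' + 1) + 1) + 1) + 1,
    fun O x n a a' r qs B hB hx hv => ?_⟩
  obtain ⟨hlt, hget⟩ := List.getElem?_eq_some_iff.1 hv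
  have h1 := hp O x n a a' r qs B hB hx hlt
  set v := posVal (Counter.val n a a') q
  have h5 := hp' O (x.set v true) n a a' (decide (x.set v true ∈ O) :: r)
    (qs ++ [x.set v true]) B hB (by simpa using hx) (by simpa using hlt)
  -- Writing a zero restores the input because the letter was a zero.
  have e1 : (x.set v true).set v false = x := by
    rw [List.set_set, ← hget, List.set_getElem_self]
  rw [e1] at h5
  set y := x.set v true
  have hy : y.length = x.length := List.length_set
  have h2 := (runs_drain_one (O := O) (k := .inp) (k₁ := .rev) (by simp)
    (.std y n a a' r qs)).congr_conf (s₂ := (Conf.std [] n a a' r qs).set .rev y.reverse) (by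
      refine Conf.ext_stk (fun k => ?_) rfl
      cases k <;> simp [Conf.std])
  have h3 := (runs_drain_two (O := O) (k := .rev) (k₁ := .inp) (k₂ := .qry) (by simp) (by simp)
    (by simp) ((Conf.std [] n a a' r qs).set .rev y.reverse)).congr_conf
    (s₂ := (Conf.std y n a a' r qs).set .qry y) (by
      refine Conf.ext_stk (fun k => ?_) rfl
      cases k <;> simp [Conf.std])
  have h4 := (Runs.query (O := O) ((Conf.std y n a a' r qs).set .qry y)).congr_conf
    (s₂ := Conf.std y n a a' (decide (y ∈ O) :: r) (qs ++ [y])) (by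
      refine Conf.ext_stk (fun k => ?_) (by simp [Conf.std])
      cases k <;> simp [Conf.std])
  refine (h1.seq (h2.seq (h3.seq (h4.seq h5)))).mono ?_
  have e2 : ((Conf.std y n a a' r qs).stk .inp).length ≤ B := by
    change y.length ≤ B; omega
  have e3 : (((Conf.std [] n a a' r qs).set .rev y.reverse).stk .rev).length ≤ B := by
    simp; omega
  simp only [eval_add, eval_mul, eval_one, eval_X, eval_ofNat]
  gcongr

end

open Classical Polynomial in
/-- Formulas are evaluated in polynomial time. -/
theorem runs_prog {l : ℕ} (F : Fml l) : ∃ p : Polynomial ℕ, ∀ (O : Set Word) (x : Word) (n : ℕ)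
    (a a' : ℕ → ℕ) (r : List Bool) (qs : List Word) (B : ℕ),
    (∀ c : Counter, c.val n a a' ≤ B) → x.length ≤ B → (∀ i, l ≤ i → a i = 0 ∧ a' i = 0) →
    Runs O F.prog (.std x n a a' r qs)
      (.std x n a a' (F.val O x n a a' :: r) (qs ++ F.asks O x n a a')) (p.eval B) := by
  induction F with
  | const b =>
    refine ⟨1, fun O x n a a' r qs B _ _ _ => ?_⟩
    simpa [Fml.asks, Fml.val, Fml.prog] using runs_push_res (O := O) b
  | look q c =>
    obtain ⟨p, hp⟩ := runs_look q c
    refine ⟨p, fun O x n a a' r qs B hB hx _ => ?_⟩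
    simpa [Fml.asks, Fml.val, Fml.prog] using hp O x n a a' r qs B hB hx
  | ask q =>
    obtain ⟨p, hp⟩ := runs_look q (· == some false)
    obtain ⟨p', hp'⟩ := runs_askAt q
    refine ⟨p + ((1 + p' + 1) + 1) + 1, fun O x n a a' r qs B hB hx _ => ?_⟩
    have h1 := hp O x n a a' r qs B hB hx
    simp only [eval_add, eval_one]
    simp only [Fml.val, Fml.asks]
    by_cases hv : x[posVal (Counter.val n a a') q]? = some false
    · rw [if_pos hv]
      simp only [hv, true_and]
      rw [show (x[posVal (Counter.val n a a') q]? == some false) = true by simp [hv]] at h1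
      exact h1.seq (Runs.branch_true (by simp [Conf.std])
        ((runs_pop_res _).seq (hp' O x n a a' r qs B hB hx hv)))
    · rw [if_neg hv]
      simp only [hv, false_and, decide_false, List.append_nil]
      rw [show (x[posVal (Counter.val n a a') q]? == some false) = false by simp [hv]] at h1
      exact (h1.seq (Runs.branch_false (by simp [Conf.std]) (runs_skip rfl))).mono (by omega)
  | ite F G H ihF ihG ihH =>
    obtain ⟨p, hp⟩ := ihF
    obtain ⟨p₁, hp₁⟩ := ihG
    obtain ⟨p₂, hp₂⟩ := ihH
    refine ⟨p + ((1 + (p₁ + p₂) + 1) + 1) + 1, fun O x n a a' r qs B hB hx ha => ?_⟩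
    have h1 := hp O x n a a' r qs B hB hx ha
    simp only [eval_add, eval_one]
    simp only [Fml.val, Fml.asks]
    cases hb : F.val O x n a a'
    · rw [hb] at h1
      have h2 := hp₂ O x n a a' r (qs ++ F.asks O x n a a') B hB hx ha
      refine ((h1.seq (Runs.branch_false (by simp [Conf.std])
        ((runs_pop_res _).seq h2))).congr_conf ?_).mono (by omega)
      simp
    · rw [hb] at h1
      have h2 := hp₁ O x n a a' r (qs ++ F.asks O x n a a') B hB hx ha
      refine ((h1.seq (Runs.branch_true (by simp [Conf.std])
        ((runs_pop_res _).seq h2))).congr_conf ?_).mono (by omega)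
      simp
  | and F G ihF ihG =>
    obtain ⟨p, hp⟩ := ihF
    obtain ⟨p₁, hp₁⟩ := ihG
    refine ⟨p + (p₁ + 6 + 1) + 1, fun O x n a a' r qs B hB hx ha => ?_⟩
    have h1 := hp O x n a a' r qs B hB hx ha
    have h2 := hp₁ O x n a a' (F.val O x n a a' :: r) (qs ++ F.asks O x n a a') B hB hx ha
    simp only [eval_add, eval_one, eval_ofNat]
    simp only [Fml.val, Fml.asks]
    refine (h1.seq (h2.seq (runs_conj _ _))).congr_conf ?_
    simp
  | @all l F ih =>
    obtain ⟨p, hp⟩ := ih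
    refine ⟨1 + ((4 * X + 3) + ((X * ((p + (6 + (1 + 1 + 1) + 1) + 1) + 1) + 1) + (2 * X + 1) + 1)
      + 1) + 1, fun O x n a a' r qs B hB hx ha => ?_⟩
    have hn : n ≤ B := hB .dim
    -- Loop invariant: the result and the queries of the first `j` instances have been accumulated.
    let f : ℕ → Conf := fun j => .std x n (Function.update a l j) (Function.update a' l (n - j))
      (((List.range j).all fun j =>
        F.val O x n (Function.update a l j) (Function.update a' l (n - j))) :: r)
      (qs ++ (List.range j).flatMap fun j =>
        F.asks O x n (Function.update a l j) (Function.update a' l (n - j)))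
    have hl := ha l le_rfl
    have h1 := runs_push_res (O := O) (x := x) (n := n) (a := a) (a' := a') (r := r) (qs := qs) true
    have h2 := (runs_copy (O := O) (k := .dim) (k' := .cov l) (by simp) (by simp) (by simp)
      (s := .std x n a a' (true :: r) qs) rfl).congr_conf (s₂ := f 0) (by
        have e : (((Conf.std x n a a' (true :: r) qs).stk .dim).reverse ++
            (Conf.std x n a a' (true :: r) qs).stk (.cov l)) = List.replicate n true := by
          simp [Conf.std, hl]
        rw [e, Conf.std_set_cov]
        -- Variables from `l` on have empty stacks, so `var l` already holds the initial value `0`.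
        simp [f, show Function.update a l 0 = a by rw [← hl.1, Function.update_eq_self]])
    have h3 := runs_loop (O := O) (k := .cov l) (c := Option.isSome)
      (p := .seq F.prog (.seq .conj (.seq (.move (.cov l) []) (.push (.var l) true))))
      (t := p.eval B + (6 + (1 + 1 + 1) + 1) + 1) n f
      (fun j hj => by simp [f, Conf.std, List.head?_replicate]; omega) (fun j hj => ?_)
      (by simp [f, Conf.std])
    · have h4 := (runs_drain_nil (O := O) (.var l) (f n)).congr_conf
        (s₂ := .std x n a a' ((Fml.all F).val O x n a a' :: r)
          (qs ++ (Fml.all F).asks O x n a a')) (by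
            rw [show ([] : Word) = List.replicate 0 true from rfl, Conf.std_set_var]
            have e1 : Function.update a' l 0 = a' := by
              rw [← hl.2, Function.update_eq_self]
            have e2 : Function.update a l 0 = a := by
              rw [← hl.1, Function.update_eq_self]
            simp [Fml.val, Fml.asks, e1, e2])
      refine (h1.seq (h2.seq (h3.seq h4))).mono ?_
      have e1 : ((f n).stk (.var l)).length ≤ B := by simpa [f, Conf.std] using hn
      have e2 : ((Conf.std x n a a' (true :: r) qs).stk .dim).length ≤ B := by
        simpa [Conf.std] using hn
      simp only [eval_add, eval_mul, eval_one, eval_X, eval_ofNat]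
      gcongr
    · have h4 := hp O x n (Function.update a l j) (Function.update a' l (n - j))
        (((List.range j).all fun j =>
          F.val O x n (Function.update a l j) (Function.update a' l (n - j))) :: r)
        (qs ++ (List.range j).flatMap fun j =>
          F.asks O x n (Function.update a l j) (Function.update a' l (n - j))) B ?_ hx ?_
      · have e : (Conf.std x n (Function.update a l j) (Function.update a' l (n - j))
            (((List.range (j + 1)).all fun j =>
              F.val O x n (Function.update a l j) (Function.update a' l (n - j))) :: r)
            (qs ++ (List.range (j + 1)).flatMap fun j =>
              F.asks O x n (Function.update a l j) (Function.update a' l (n - j)))).stk (.cov l) =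
            true :: List.replicate (n - (j + 1)) true := by
          simp only [Conf.std, Function.update_self]
          rw [← List.replicate_succ]
          congr 1; omega
        have h5 := Runs.move (O := O) (.cov l) [] (.std x n (Function.update a l j)
          (Function.update a' l (n - j)) (((List.range (j + 1)).all fun j =>
            F.val O x n (Function.update a l j) (Function.update a' l (n - j))) :: r)
          (qs ++ (List.range (j + 1)).flatMap fun j =>
            F.asks O x n (Function.update a l j) (Function.update a' l (n - j))))
        rw [Conf.move_cons _ e, Conf.pushAll, Conf.std_set_cov, Function.update_idem] at h5
        have h6 := (Runs.push (O := O) (.var l) true (.std x n (Function.update a l j)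
            (Function.update a' l (n - (j + 1))) (((List.range (j + 1)).all fun j =>
              F.val O x n (Function.update a l j) (Function.update a' l (n - j))) :: r)
            (qs ++ (List.range (j + 1)).flatMap fun j =>
              F.asks O x n (Function.update a l j) (Function.update a' l (n - j))))).congr_conf
            (s₂ := f (j + 1)) (by
          have e' : (true :: (Conf.std x n (Function.update a l j)
              (Function.update a' l (n - (j + 1))) (((List.range (j + 1)).all fun j =>
              F.val O x n (Function.update a l j) (Function.update a' l (n - j))) :: r)
              (qs ++ (List.range (j + 1)).flatMap fun j =>
              F.asks O x n (Function.update a l j) (Function.update a' l (n - j)))).stk (.var l)) =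
              List.replicate (j + 1) true := by
            simp [Conf.std, List.replicate_succ]
          rw [e', Conf.std_set_var, Function.update_idem])
        exact h4.seq (((runs_conj _ _).congr_conf (by simp [List.range_succ])).seq (h5.seq h6))
      · intro c
        cases c with
        | dim => exact hn
        | var i =>
          by_cases hi : i = l
          · subst hi; simp [Counter.val]; omega
          · simpa [Counter.val, hi] using hB (.var i)
        | cov i =>
          by_cases hi : i = l
          · subst hi; simp [Counter.val]; omega
          · simpa [Counter.val, hi] using hB (.cov i)
      · intro i hi
        have : i ≠ l := by omega
        simpa [this] using ha i (by omega)

/-! ### The machine of a formula -/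

/-- The number of leading ones of a word. -/
def lead (x : Word) : ℕ := (x.takeWhile id).length

/-- A description by single letters; it is insensitive to changes further to the right, such as the
addition of a tuple. -/
theorem lead_eq_iff {x : Word} {n : ℕ} :
    lead x = n ↔ (∀ j < n, x[j]? = some true) ∧ x[n]? ≠ some true := by
  induction x generalizing n with
  | nil =>
    simp only [lead, List.takeWhile_nil, List.length_nil, List.getElem?_nil]
    constructor
    · rintro rfl; simp
    · rintro ⟨h, _⟩
      by_contra hn
      simpa using h 0 (by omega)
  | cons b x ih =>
    cases b
    · simp only [lead, List.takeWhile_cons, id]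
      constructor
      · intro h
        have : n = 0 := by simpa using h.symm
        subst this; simp
      · rintro ⟨h, _⟩
        by_contra hn
        have : 0 < n := by simp at hn; omega
        simpa using h 0 this
    · cases n with
      | zero => simp [lead]
      | succ n =>
        have : lead (true :: x) = lead x + 1 := by simp [lead]
        rw [this, add_left_inj, ih]
        constructor
        · rintro ⟨h, h'⟩
          refine ⟨fun j hj => ?_, by simpa using h'⟩
          cases j with
          | zero => simp
          | succ j => simpa using h j (by omega)
        · rintro ⟨h, h'⟩
          exact ⟨fun j hj => by simpa using h (j + 1) (by omega), by simpa using h'⟩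

theorem lead_le (x : Word) : lead x ≤ x.length := (List.takeWhile_sublist _).length_le

namespace Prog

/-- Count the leading ones. -/
def count : Prog := seq (loop .inp (· == some true) (move .inp [.rev, .dim])) back

end Prog

open Polynomial in
theorem runs_count (O : Set Word) (x : Word) :
    Runs O .count (.std x 0 0 0 [] []) (.std x (lead x) 0 0 [] []) (4 * x.length + 3) := by
  obtain ⟨ht, hf⟩ := lead_eq_iff.1 (rfl : lead x = lead x)
  have hle := lead_le x
  set n := lead x
  let f : ℕ → Conf := fun j => (Conf.std (x.drop j) j 0 0 [] []).set .rev (List.replicate j true)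
  have h1 := runs_loop (O := O) (k := .inp) (c := (· == some true))
    (p := .move .inp [.rev, .dim]) (t := 1) n f
    (fun j hj => by simp [f, Conf.std, ht j hj]) (fun j hj => ?_) (by simpa [f, Conf.std] using hf)
  · refine ((h1.congr_conf' ?_).seq (runs_back O _ _ _ _ _ _ _)).congr_conf ?_ |>.mono ?_
    · refine Conf.ext_stk (fun k => ?_) rfl
      cases k <;> simp [Conf.std, f]
    · congr 1
      have : x.take n = List.replicate n true := by
        refine List.ext_getElem (by simpa using hle) fun j h h' => ?_
        have h2 := ht j (by simpa using h')
        rw [List.getElem?_eq_some_iff] at h2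
        obtain ⟨_, h2⟩ := h2
        simpa using h2
      rw [List.reverse_replicate, ← this, List.take_append_drop]
    · simp; omega
  · have hj' : j < x.length := by omega
    refine (Runs.move _ _ _).congr_conf ?_
    have h2 := (List.getElem?_eq_some_iff.1 (ht j hj)).2
    rw [Conf.move_cons (b := true) (w := x.drop (j + 1)) _
      (by simp [f, Conf.std, List.drop_eq_getElem_cons hj', h2])]
    refine Conf.ext_stk (fun k => ?_) rfl
    cases k <;> simp [Conf.std, f, Conf.pushAll, List.replicate_succ]

/-- The oracle machine that evaluates a formula. -/
noncomputable def Fml.machine (F : Fml 0) : OracleMachine :=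
  -- A halting configuration must have empty stacks apart from the output, hence the two drains at
  -- the end.
  Prog.machine (.seq .count (.seq F.prog (.seq (.drain .inp []) (.drain .dim []))))

-- Together with `OracleMachine.Run.unique` this reduces all questions about the machine to `val`
-- and `asks`.
open Polynomial in
theorem Fml.exists_run (F : Fml 0) : ∃ p : Polynomial ℕ, ∀ (O : Set Word) (x : Word),
    F.machine.Run O x (F.val O x (lead x) 0 0) (F.asks O x (lead x) 0 0) (p.eval x.length) := by
  obtain ⟨p, hp⟩ := runs_prog F
  refine ⟨(4 * X + 3) + (p + ((2 * X + 1) + (2 * X + 1) + 1) + 1) + 1 + 1, fun O x => ?_⟩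
  have hle := lead_le x
  have h1 := hp O x (lead x) 0 0 [] [] x.length
    (by intro c; cases c <;> simp [Counter.val, hle]) le_rfl (by simp)
  set b := F.val O x (lead x) 0 0
  set qs := F.asks O x (lead x) 0 0
  have h2 := (runs_drain_nil (O := O) .inp (.std x (lead x) 0 0 [b] ([] ++ qs))).congr_conf
    (s₂ := .std [] (lead x) 0 0 [b] qs) (by rw [Conf.std_set_inp, List.nil_append])
  have h3 := (runs_drain_nil (O := O) .dim (.std [] (lead x) 0 0 [b] qs)).congr_conf
    (s₂ := ⟨Function.update (fun _ => []) .res [b], qs⟩) (by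
      refine Conf.ext_stk (fun k => ?_) rfl
      cases k <;> simp [Conf.std])
  have e : Conf.std x 0 0 0 [] [] = ⟨Function.update (fun _ => []) .inp x, []⟩ := by
    refine Conf.ext_stk (fun k => ?_) rfl
    cases k <;> simp [Conf.std]
  have h4 := ((runs_count O x).congr_conf' e).seq (h1.seq (h2.seq h3))
  have e1 : ((Conf.std x (lead x) 0 0 [b] ([] ++ qs)).stk .inp).length ≤ x.length := le_rfl
  have e2 : ((Conf.std [] (lead x) 0 0 [b] qs).stk .dim).length ≤ x.length := by
    simpa [Conf.std] using hle
  simp only [eval_add, eval_mul, eval_one, eval_X, eval_ofNat]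
  exact Prog.machine_run (h4.mono (by gcongr))

/-! ### Positions in the encoding of a structure -/

theorem getElem?_flatMap {α β : Type*} (f : α → List β) {l : List α} {i : ℕ} (hi : i < l.length)
    {a : α} (ha : l[i] = a) {t : ℕ} (ht : t < (f a).length) :
    (l.flatMap f)[((l.take i).map fun a => (f a).length).sum + t]? = (f a)[t]? := by
  subst ha
  have h : l = l.take i ++ l[i] :: l.drop (i + 1) := by
    rw [← List.drop_eq_getElem_cons hi, List.take_append_drop]
  conv_lhs => rw [h]
  rw [List.flatMap_append, ← h, ← List.length_flatMap, List.getElem?_append_right (by omega),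
    Nat.add_sub_cancel_left, List.flatMap_cons, List.getElem?_append_left ht]

theorem exists_eq_sum_take_add (l : List ℕ) {p : ℕ} (h : p < l.sum) :
    ∃ (i : ℕ) (hi : i < l.length) (t : ℕ), t < l[i] ∧ p = (l.take i).sum + t := by
  induction l generalizing p with
  | nil => simp at h
  | cons a l ih =>
    by_cases hp : p < a
    · exact ⟨0, by simp, p, by simpa using hp, by simp⟩
    · obtain ⟨i, hi, t, ht, he⟩ := ih (p := p - a) (by simp at h; omega)
      exact ⟨i + 1, by simpa using hi, t, by simpa using ht, by simp; omega⟩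

/-- A position in one block lies before the start of every later block. Taking `j` to be the number
of blocks bounds it by the total length. -/
theorem sum_take_add_lt (l : List ℕ) {i j : ℕ} (hij : i < j) (hj : j ≤ l.length) {t : ℕ}
    (ht : t < l[i]) : (l.take i).sum + t < (l.take j).sum := by
  have h1 : (l.take (i + 1)).sum = (l.take i).sum + l[i] := by
    rw [List.take_succ_eq_append_getElem (by omega), List.sum_append, List.sum_singleton]
  have h2 : (l.take (i + 1)).sum ≤ (l.take j).sum := by
    have : l.take (i + 1) = (l.take j).take (i + 1) := by
      rw [List.take_take, min_eq_left (by omega)]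
    rw [this]
    exact (List.take_sublist _ _).sum_le_sum (by simp)
  omega

section Encoding

variable {τ : FirstOrder.Language.{0, 0}} {k : ℕ} (e : Fin k ≃ Σ r, τ.Relations r)

/-- The lengths of the tables in the encoding of a structure with `n` elements. -/
def tableLengths (n : ℕ) : List ℕ := (List.finRange k).map fun i => n ^ (e i).1

/-- The position of the letter for the `t`-th tuple in the `i`-th table. -/
def relPos (n i t : ℕ) : ℕ := n + 1 + ((tableLengths e n).take i).sum + t

/-- The word `x` has the form of the encoding of a structure. -/
def Valid (x : Word) : Prop := 0 < lead x ∧ x.length = lead x + 1 + (tableLengths e (lead x)).sum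

/-- The structure that is encoded by `x`. -/
@[reducible] def decodeStructure (hτ : τ.IsRelational) (x : Word) (n : ℕ) :
    τ.Structure (Fin n) where
  funMap f := ((hτ _).false f).elim
  RelMap {r} R ts := x[relPos e n (e.symm ⟨r, R⟩) (finFunctionFinEquiv ts)]? = some true

theorem relMap_decodeStructure (hτ : τ.IsRelational) (x : Word) (n : ℕ) {r : ℕ}
    (R : τ.Relations r) (ts : Fin r → Fin n) : (decodeStructure e hτ x n).RelMap R ts ↔
      x[relPos e n (e.symm ⟨r, R⟩) (finFunctionFinEquiv ts)]? = some true := Iff.rfl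

@[simp] theorem length_tableLengths (n : ℕ) : (tableLengths e n).length = k := by
  simp [tableLengths]

theorem getElem_tableLengths (n : ℕ) {i : ℕ} (hi : i < (tableLengths e n).length) :
    (tableLengths e n)[i] = n ^ (e ⟨i, by simpa using hi⟩).1 := by
  simp [tableLengths]

/-- The tables occupy disjoint intervals, so each letter behind the unary prefix belongs to at most
one tuple of one relation. -/
theorem relPos_inj {n i j t u : ℕ} (hi : i < k) (hj : j < k) (ht : t < n ^ (e ⟨i, hi⟩).1)
    (hu : u < n ^ (e ⟨j, hj⟩).1) (h : relPos e n i t = relPos e n j u) : i = j ∧ t = u := by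
  unfold relPos at h
  rcases lt_trichotomy i j with hij | rfl | hij
  · have := sum_take_add_lt (tableLengths e n) hij (by simpa using hj.le) (t := t)
      (by rwa [getElem_tableLengths])
    omega
  · exact ⟨rfl, by omega⟩
  · have := sum_take_add_lt (tableLengths e n) hij (by simpa using hi.le) (t := u)
      (by rwa [getElem_tableLengths])
    omega

theorem relPos_lt {n i t : ℕ} (hi : i < k) (ht : t < n ^ (e ⟨i, hi⟩).1) :
    relPos e n i t < n + 1 + (tableLengths e n).sum := by
  have := sum_take_add_lt (tableLengths e n) hi (by simp) (t := t)
    (by rwa [getElem_tableLengths])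
  rw [List.take_of_length_le (i := k) (by simp)] at this
  unfold relPos
  omega

theorem length_encodeStructure (n : ℕ) (S : τ.Structure (Fin n)) :
    (encodeStructure e n S).length = n + 1 + (tableLengths e n).sum := by
  simp [encodeStructure, tableLengths, List.length_flatMap]
  omega

theorem lead_encodeStructure (n : ℕ) (S : τ.Structure (Fin n)) :
    lead (encodeStructure e n S) = n := by
  rw [lead_eq_iff]
  refine ⟨fun j hj => ?_, ?_⟩
  · rw [encodeStructure, List.append_assoc, List.getElem?_append_left (by simpa using hj)]
    simp [hj]
  · simp [encodeStructure]

open Classical in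
theorem getElem?_encodeStructure (n : ℕ) (S : τ.Structure (Fin n)) (i : Fin k)
    (t : Fin (n ^ (e i).1)) : (encodeStructure e n S)[relPos e n i t]? =
      some (decide (S.RelMap (e i).2 (finFunctionFinEquiv.symm t))) := by
  have h1 : ((tableLengths e n).take i).sum = ((((List.finRange k).take i).map fun i =>
      (List.ofFn fun j : Fin (n ^ (e i).1) =>
        decide (S.RelMap (e i).2 (finFunctionFinEquiv.symm j))).length)).sum := by
    simp [tableLengths, List.map_take]
  have h2 := getElem?_flatMap (fun i => List.ofFn fun j : Fin (n ^ (e i).1) =>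
    decide (S.RelMap (e i).2 (finFunctionFinEquiv.symm j))) (l := List.finRange k) (i := i)
    (by simp) (a := i) (by simp) (t := t) (by simp)
  rw [← h1] at h2
  unfold encodeStructure
  rw [List.append_assoc, List.getElem?_append_right (by simp [relPos]; omega),
    List.getElem?_append_right (by simp [relPos]; omega)]
  rw [show relPos e n i t - (List.replicate n true).length - [false].length =
    ((tableLengths e n).take i).sum + t by simp [relPos]; omega]
  rw [h2]
  simp

variable (hτ : τ.IsRelational)

theorem decode_encodeStructure (n : ℕ) (S : τ.Structure (Fin n)) :
    decodeStructure e hτ (encodeStructure e n S) n = S := by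
  have hrel : ∀ (s : Σ r, τ.Relations r) (ts : Fin s.1 → Fin n),
      (decodeStructure e hτ (encodeStructure e n S) n).RelMap s.2 ts = S.RelMap s.2 ts := by
    intro s ts
    obtain ⟨i, rfl⟩ := e.surjective s
    have h := getElem?_encodeStructure e n S i (finFunctionFinEquiv ts)
    refine propext ?_
    rw [relMap_decodeStructure, Sigma.eta, Equiv.symm_apply_apply, h]
    simp
  refine FirstOrder.Language.Structure.ext ?_ ?_
  · funext m f
    exact ((hτ m).false f).elim
  · funext r R ts
    exact hrel ⟨r, R⟩ ts

/-- The words are compared on three ranges: the unary prefix, the zero that closes it, and the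
tables. The length condition in `Valid` ensures that every later position lies in some table. -/
theorem encode_decodeStructure {x : Word} (hx : Valid e x) :
    encodeStructure e (lead x) (decodeStructure e hτ x (lead x)) = x := by
  obtain ⟨ht, hf⟩ := lead_eq_iff.1 (rfl : lead x = lead x)
  have hlead := lead_encodeStructure e (lead x) (decodeStructure e hτ x (lead x))
  obtain ⟨ht', hf'⟩ := lead_eq_iff.1 hlead
  have hlen := length_encodeStructure e (lead x) (decodeStructure e hτ x (lead x))
  set y := encodeStructure e (lead x) (decodeStructure e hτ x (lead x)) with hy
  refine List.ext_getElem (by rw [hlen, hx.2]) fun p hp hp' => ?_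
  rcases lt_trichotomy p (lead x) with h | h | h
  · have h1 := ht p h
    have h2 := ht' p h
    rw [List.getElem?_eq_getElem hp'] at h1
    rw [List.getElem?_eq_getElem hp] at h2
    exact Option.some_injective _ (h2.trans h1.symm)
  · subst h
    rw [List.getElem?_eq_getElem hp'] at hf
    rw [List.getElem?_eq_getElem hp] at hf'
    simp only [ne_eq, Option.some.injEq, Bool.not_eq_true] at hf hf'
    rw [hf, hf']
  · obtain ⟨i, hi, t, hti, he⟩ := exists_eq_sum_take_add (tableLengths e (lead x))
      (p := p - (lead x + 1)) (by rw [hx.2] at hp'; omega)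
    have hik : i < k := by simpa using hi
    rw [getElem_tableLengths] at hti
    have hpe : relPos e (lead x) i t = p := by unfold relPos; omega
    have h1 := getElem?_encodeStructure e (lead x) (decodeStructure e hτ x (lead x)) ⟨i, hik⟩
      ⟨t, hti⟩
    rw [← hy] at h1
    simp only [relMap_decodeStructure, Sigma.eta, Equiv.symm_apply_apply, Equiv.apply_symm_apply,
      hpe, List.getElem?_eq_getElem hp, List.getElem?_eq_getElem hp'] at h1
    simpa using h1

theorem valid_encodeStructure {n : ℕ} (hn : 0 < n) (S : τ.Structure (Fin n)) :
    Valid e (encodeStructure e n S) := by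
  rw [Valid, lead_encodeStructure, length_encodeStructure]
  exact ⟨hn, rfl⟩

/-- Encoding and decoding are mutually inverse between valid words and structures on `Fin n` with `n
> 0`; no closure of the class under isomorphism is needed. -/
theorem mem_wordsOf_iff (C : Set (CategoryTheory.Bundled.{0} τ.Structure)) (x : Word) :
    x ∈ wordsOf e C ↔ Valid e x ∧
      (⟨Fin (lead x), decodeStructure e hτ x (lead x)⟩ : CategoryTheory.Bundled τ.Structure) ∈ C := by
  constructor
  · rintro ⟨n, S, hn, hS, rfl⟩
    refine ⟨valid_encodeStructure e hn S, ?_⟩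
    rw [lead_encodeStructure, decode_encodeStructure]
    exact hS
  · rintro ⟨hx, hC⟩
    exact ⟨lead x, _, hx.1, hC, (encode_decodeStructure e hτ hx).symm⟩

theorem lead_set {x : Word} {p : ℕ} (hp : lead x < p) (b : Bool) : lead (x.set p b) = lead x := by
  obtain ⟨ht, hf⟩ := lead_eq_iff.1 (rfl : lead x = lead x)
  rw [lead_eq_iff]
  refine ⟨fun j hj => ?_, ?_⟩
  · rw [List.getElem?_set_ne (by omega)]
    exact ht j hj
  · rwa [List.getElem?_set_ne (by omega)]

theorem lead_lt_relPos (n i t : ℕ) : n < relPos e n i t := by unfold relPos; omega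

theorem valid_set {x : Word} (hx : Valid e x) {p : ℕ} (hp : lead x < p) (b : Bool) :
    Valid e (x.set p b) := by
  rw [Valid, lead_set hp, List.length_set]
  exact hx

/-- Changing a bit of the word adds a tuple to a relation. -/
theorem decodeStructure_set {x : Word} (hx : Valid e x) {r r' : ℕ} (R : τ.Relations r)
    (ts : Fin r → Fin (lead x)) (R' : τ.Relations r') (ts' : Fin r' → Fin (lead x)) :
    (decodeStructure e hτ (x.set (relPos e (lead x) (e.symm ⟨r, R⟩) (finFunctionFinEquiv ts)) true)
      (lead x)).RelMap R' ts' ↔ (decodeStructure e hτ x (lead x)).RelMap R' ts' ∨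
        ∃ h : r = r', h ▸ R = R' ∧ ts = ts' ∘ Fin.cast h := by
  have hpos : ∀ (s : Σ r, τ.Relations r) (us : Fin s.1 → Fin (lead x)),
      (finFunctionFinEquiv us : ℕ) < lead x ^ (e ⟨e.symm s, (e.symm s).2⟩).1 := by
    intro s us
    obtain ⟨i, rfl⟩ := e.surjective s
    simpa using (finFunctionFinEquiv us).2
  have hlt := relPos_lt e (e.symm ⟨r, R⟩).2 (hpos ⟨r, R⟩ ts)
  rw [← hx.2] at hlt
  simp only [relMap_decodeStructure, List.getElem?_set]
  -- By `relPos_inj`, equal positions mean the same symbol and the same tuple; at any other position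
  -- the letter is unchanged.
  by_cases h : relPos e (lead x) (e.symm ⟨r, R⟩) (finFunctionFinEquiv ts) =
      relPos e (lead x) (e.symm ⟨r', R'⟩) (finFunctionFinEquiv ts')
  · obtain ⟨h1, h2⟩ := relPos_inj e (Fin.is_lt _) (Fin.is_lt _) (hpos ⟨r, R⟩ ts)
      (hpos ⟨r', R'⟩ ts') h
    have h3 := e.symm.injective (Fin.ext h1)
    obtain ⟨rfl, h4⟩ := Sigma.mk.inj_iff.1 h3
    obtain rfl := eq_of_heq h4
    have h5 : ts = ts' := finFunctionFinEquiv.injective (Fin.ext h2)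
    subst h5
    rw [if_pos rfl, if_pos hlt]
    exact ⟨fun _ => Or.inr ⟨rfl, rfl, rfl⟩, fun _ => rfl⟩
  · rw [if_neg h]
    refine ⟨Or.inl, ?_⟩
    rintro (h' | ⟨rfl, rfl, h'⟩)
    · exact h'
    · exact (h (by rw [h']; rfl)).elim

end Encoding

/-! ### Formulas about encodings -/

/-- The sequence of the numbers `g (ts i)`, extended by zeros. -/
def tupleVal {n l : ℕ} (g : Fin n → ℕ) (ts : Fin l → Fin n) (i : ℕ) : ℕ :=
  if h : i < l then g (ts ⟨i, h⟩) else 0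

/-- The quantifier at depth `l` binds variable `l`, so assigning it a value appends a last
coordinate. -/
theorem update_tupleVal {n l : ℕ} (g : Fin n → ℕ) (ts : Fin l → Fin n) (j : Fin n) :
    Function.update (tupleVal g ts) l (g j) = tupleVal g (Fin.snoc (α := fun _ => Fin n) ts j) := by
  funext i
  rcases lt_trichotomy i l with h | rfl | h
  · simp [tupleVal, h, h.ne, Fin.snoc, Nat.lt_succ_of_lt h]
  · simp [tupleVal, Fin.snoc]
  · have h1 : ¬ i < l := by omega
    have h2 : ¬ i < l + 1 := by omega
    simp [tupleVal, h1, h2, h.ne']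

theorem tupleVal_zero {n : ℕ} (g : Fin n → ℕ) (ts : Fin 0 → Fin n) : tupleVal g ts = 0 := by
  funext i; simp [tupleVal]

/-! ### Truth values and queries in terms of tuples of elements -/

namespace Fml

variable {O : Set Word} {x : Word} {n l : ℕ}

/-- The truth value of a formula for a tuple of elements. -/
noncomputable def holds (O : Set Word) (x : Word) (F : Fml l) (ts : Fin l → Fin n) : Prop :=
  F.val O x n (tupleVal (fun j => j) ts) (tupleVal (fun j => n - j) ts) = true

/-- The queries for a tuple of elements. -/
noncomputable def queries (O : Set Word) (x : Word) (F : Fml l) (ts : Fin l → Fin n) : List Word :=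
  F.asks O x n (tupleVal (fun j => j) ts) (tupleVal (fun j => n - j) ts)

@[simp] theorem holds_const (b : Bool) (ts : Fin l → Fin n) :
    (const b : Fml l).holds O x ts ↔ b = true := Iff.rfl

@[simp] theorem holds_ite (F G H : Fml l) (ts : Fin l → Fin n) : (ite F G H).holds O x ts ↔
    (F.holds O x ts ∧ G.holds O x ts) ∨ (¬ F.holds O x ts ∧ H.holds O x ts) := by
  unfold holds
  simp only [val]
  cases F.val O x n _ _ <;> simp

@[simp] theorem holds_and (F G : Fml l) (ts : Fin l → Fin n) : (and F G).holds O x ts ↔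
    F.holds O x ts ∧ G.holds O x ts := by
  simp [holds, val]

theorem tupleVal_snoc_aux (ts : Fin l → Fin n) {j : ℕ} (hj : j < n) :
    Function.update (tupleVal (fun j => (j : ℕ)) ts) l j =
        tupleVal (fun j => (j : ℕ)) (Fin.snoc (α := fun _ => Fin n) ts ⟨j, hj⟩) ∧
      Function.update (tupleVal (fun j => n - (j : ℕ)) ts) l (n - j) =
        tupleVal (fun j => n - (j : ℕ)) (Fin.snoc (α := fun _ => Fin n) ts ⟨j, hj⟩) :=
  ⟨update_tupleVal (fun j => (j : ℕ)) ts ⟨j, hj⟩, update_tupleVal (fun j => n - (j : ℕ)) ts ⟨j, hj⟩⟩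

@[simp] theorem holds_all (F : Fml (l + 1)) (ts : Fin l → Fin n) : (all F).holds O x ts ↔
    ∀ j : Fin n, F.holds O x (Fin.snoc (α := fun _ => Fin n) ts j) := by
  simp only [holds, val, List.all_eq_true, List.mem_range, Fin.forall_iff]
  refine forall₂_congr fun j hj => ?_
  rw [(tupleVal_snoc_aux ts hj).1, (tupleVal_snoc_aux ts hj).2]

@[simp] theorem queries_const (b : Bool) (ts : Fin l → Fin n) :
    (const b : Fml l).queries O x ts = [] := rfl

open Classical in
@[simp] theorem queries_ite (F G H : Fml l) (ts : Fin l → Fin n) : (ite F G H).queries O x ts =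
    F.queries O x ts ++ if F.holds O x ts then G.queries O x ts else H.queries O x ts := by
  unfold holds queries
  simp only [asks]
  cases F.val O x n _ _ <;> simp

@[simp] theorem queries_and (F G : Fml l) (ts : Fin l → Fin n) : (and F G).queries O x ts =
    F.queries O x ts ++ G.queries O x ts := rfl

@[simp] theorem queries_all (F : Fml (l + 1)) (ts : Fin l → Fin n) : (all F).queries O x ts =
    (List.finRange n).flatMap fun j => F.queries O x (Fin.snoc (α := fun _ => Fin n) ts j) := by
  simp only [queries, asks]
  rw [← List.map_coe_finRange_eq_range, List.flatMap_map]
  refine List.flatMap_congr fun j _ => ?_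
  rw [(tupleVal_snoc_aux ts j.2).1, (tupleVal_snoc_aux ts j.2).2]

/-- Negation. -/
def not (F : Fml l) : Fml l := ite F (const false) (const true)

@[simp] theorem holds_not (F : Fml l) (ts : Fin l → Fin n) :
    F.not.holds O x ts ↔ ¬ F.holds O x ts := by simp [not]

@[simp] theorem queries_not (F : Fml l) (ts : Fin l → Fin n) :
    F.not.queries O x ts = F.queries O x ts := by simp [not]

/-- Quantification over all variables. -/
def alls : ∀ {l}, Fml l → Fml 0
  | 0, F => F
  | _ + 1, F => alls (all F)

theorem holds_alls (F : Fml l) (us : Fin 0 → Fin n) :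
    F.alls.holds O x us ↔ ∀ ts : Fin l → Fin n, F.holds O x ts := by
  induction l with
  | zero =>
    exact ⟨fun h ts => by rwa [Subsingleton.elim ts us], fun h => h us⟩
  | succ l ih =>
    rw [alls, ih]
    simp only [holds_all]
    exact ⟨fun h ts => by simpa using h (Fin.init ts) (ts (Fin.last l)), fun h ts j => h _⟩

theorem mem_queries_alls (F : Fml l) (us : Fin 0 → Fin n) (w : Word) :
    w ∈ F.alls.queries O x us ↔ ∃ ts : Fin l → Fin n, w ∈ F.queries O x ts := by
  induction l with
  | zero =>
    exact ⟨fun h => ⟨us, h⟩, fun ⟨ts, h⟩ => by rwa [Subsingleton.elim ts us] at h⟩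
  | succ l ih =>
    rw [alls, ih]
    simp only [queries_all, List.mem_flatMap, List.mem_finRange, true_and]
    exact ⟨fun ⟨ts, j, h⟩ => ⟨_, h⟩,
      fun ⟨ts, h⟩ => ⟨Fin.init ts, ts (Fin.last l), by simpa using h⟩⟩

/-- Quantifiers run through all elements whatever the truth values are, so the oracle can influence
the queries only inside `F`. -/
theorem queries_alls_congr {O' : Set Word} (F : Fml l) (us : Fin 0 → Fin n)
    (h : ∀ ts : Fin l → Fin n, F.queries O x ts = F.queries O' x ts) :
    F.alls.queries O x us = F.alls.queries O' x us := by
  induction l with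
  | zero => exact h us
  | succ l ih =>
    exact ih _ fun ts => by simp [h]

/-- The conjunction of a list of formulas. -/
def conj : List (Fml l) → Fml l
  | [] => const true
  | F :: Fs => and F (conj Fs)

@[simp] theorem holds_conj (Fs : List (Fml l)) (ts : Fin l → Fin n) :
    (conj Fs).holds O x ts ↔ ∀ F ∈ Fs, F.holds O x ts := by
  induction Fs <;> simp [conj, *]

@[simp] theorem queries_conj (Fs : List (Fml l)) (ts : Fin l → Fin n) :
    (conj Fs).queries O x ts = Fs.flatMap fun F => F.queries O x ts := by
  induction Fs <;> simp [conj, *]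

end Fml

section Encoding

variable {τ : FirstOrder.Language.{0, 0}} {k : ℕ} (e : Fin k ≃ Σ r, τ.Relations r)

/-- The sum of the lengths of tables. -/
def tablesPos (l : List (Fin k)) : List (List Counter) :=
  l.map fun i => List.replicate (e i).1 Counter.dim

/-- The position of the letter for the relation symbol `s` and the values of the variables `vs`. -/
def atomPos (s : Σ r, τ.Relations r) (vs : Fin s.1 → ℕ) : List (List Counter) :=
  -- The summands are `n`, the empty product `1` for the closing zero, the lengths of the preceding
  -- tables, and `aᵢ * n ^ i` for the coordinates of the tuple.
  [Counter.dim] :: [] :: (tablesPos e ((List.finRange k).take (e.symm s)) ++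
    (List.finRange s.1).map fun i => Counter.var (vs i) :: List.replicate i Counter.dim)

theorem posVal_append (v : Counter → ℕ) (q q' : List (List Counter)) :
    posVal v (q ++ q') = posVal v q + posVal v q' := by simp [posVal]

theorem posVal_tablesPos (v : Counter → ℕ) (l : List (Fin k)) :
    posVal v (tablesPos e l) = (l.map fun i => v .dim ^ (e i).1).sum := by
  simp [posVal, tablesPos, Function.comp_def]

theorem posVal_atomPos {l n : ℕ} (s : Σ r, τ.Relations r) (vs : Fin s.1 → Fin l)
    (ts : Fin l → Fin n) :
    posVal (Counter.val n (tupleVal (fun j => j) ts) (tupleVal (fun j => n - j) ts))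
      (atomPos e s fun i => vs i) = relPos e n (e.symm s) (finFunctionFinEquiv (ts ∘ vs)) := by
  have h1 : ∀ (v : Counter → ℕ) (q : List (List Counter)), posVal v ([Counter.dim] :: [] :: q) =
      v .dim + 1 + posVal v q := by intro v q; simp [posVal]; ring
  rw [atomPos, h1, posVal_append, posVal_tablesPos, relPos, finFunctionFinEquiv_apply]
  rw [show Counter.val n (tupleVal (fun j => (j : ℕ)) ts) (tupleVal (fun j => n - (j : ℕ)) ts) .dim
    = n from rfl, add_assoc (n + 1)]
  congr 1
  congr 1
  · simp [tableLengths, List.map_take]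
  · simp [posVal, Function.comp_def, Counter.val, tupleVal, ← List.ofFn_eq_map, List.sum_ofFn]

/-- The formula that holds if the input has the form of an encoding. -/
def validFml : Fml 0 :=
  -- The empty sum is position `0`, where a one means `n > 0`. The length is exact because the last
  -- expected letter exists and the next one does not.
  .and (.look [] (· == some true)) (.and
    (.look ([Counter.dim] :: tablesPos e (List.finRange k)) Option.isSome)
    (.look ([Counter.dim] :: [] :: tablesPos e (List.finRange k)) Option.isNone))

theorem holds_validFml (O : Set Word) (x : Word) (us : Fin 0 → Fin (lead x)) :
    (validFml e).holds O x us ↔ Valid e x := by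
  obtain ⟨ht, hf⟩ := lead_eq_iff.1 (rfl : lead x = lead x)
  have h0 : x[0]? = some true ↔ 0 < lead x := by
    refine ⟨fun h => ?_, fun h => ht 0 h⟩
    by_contra h'
    rw [show lead x = 0 by omega] at hf
    exact hf h
  have h1 : ∀ (v : Counter → ℕ) (q : List (List Counter)), posVal v ([Counter.dim] :: q) =
      v .dim + posVal v q := by intro v q; simp [posVal]
  have h2 : ∀ (v : Counter → ℕ) (q : List (List Counter)), posVal v ([] :: q) =
      1 + posVal v q := by intro v q; simp [posVal]
  simp only [validFml, Fml.holds_and]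
  simp only [Fml.holds, Fml.val, h1, h2, posVal_tablesPos, Counter.val]
  rw [show posVal (Counter.val (lead x) (tupleVal (fun j => (j : ℕ)) us)
    (tupleVal (fun j => lead x - (j : ℕ)) us)) [] = 0 from rfl, Valid, tableLengths, ← h0]
  simp
  omega

theorem queries_validFml (O : Set Word) (x : Word) {n : ℕ} (us : Fin 0 → Fin n) :
    (validFml e).queries O x us = [] := rfl

variable {σ : FirstOrder.Language.{0, 0}} (prime : ∀ r, σ.Relations r → τ.Relations r)

/-- The number of the variable that is a given term. -/
def varIndex {L : FirstOrder.Language.{0, 0}} {l : ℕ} : L.Term (Empty ⊕ Fin l) → ℕ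
  | .var (Sum.inr i) => i
  -- Irrelevant for relational signatures, where every such term is a bound variable
  -- (`exists_term_eq_var`).
  | _ => 0

/-- The translation of a first-order formula, where `prime` is substituted for the symbols
of `σ`. -/
def translate : ∀ {l}, (τ.sum σ).BoundedFormula Empty l → Fml l
  | _, .falsum => .const false
  -- The positions `a + (n - b)` and `b + (n - a)` add up to `2n`. If `a = b`, both are the closing
  -- zero of the unary prefix; otherwise one of them is smaller than `n`, where the letter is a one.
  | _, .equal t u => .and
      (.look [[.var (varIndex t)], [.cov (varIndex u)]] (· == some false))
      (.look [[.var (varIndex u)], [.cov (varIndex t)]] (· == some false))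
  | _, .rel (l := r) R ts => .look
      (atomPos e ⟨r, Sum.elim id (prime r) R⟩ fun i => varIndex (ts i)) (· == some true)
  | _, .imp φ ψ => .ite (translate φ) (translate ψ) (.const true)
  | _, .all φ => .all (translate φ)

theorem queries_translate {l n : ℕ} (φ : (τ.sum σ).BoundedFormula Empty l) (O : Set Word)
    (x : Word) (ts : Fin l → Fin n) : (translate e prime φ).queries O x ts = [] := by
  induction φ with
  | falsum => rfl
  | equal t u => rfl
  | rel R us => rfl
  | imp φ ψ ih ih' => simp [translate, ih, ih']
  | all φ ih => simp [translate, ih]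

theorem exists_term_eq_var {L : FirstOrder.Language.{0, 0}} (hL : L.IsRelational) {l : ℕ}
    (t : L.Term (Empty ⊕ Fin l)) : ∃ i : Fin l, t = .var (Sum.inr i) := by
  rcases t with (a | i) | ⟨f, _⟩
  · exact a.elim
  · exact ⟨i, rfl⟩
  · exact ((hL _).false f).elim

/-- Replacing each quantified symbol by its partner amounts to evaluating `φ` in the expansion in
which both have the same interpretation; this is what `hS` demands. -/
theorem holds_translate (hτ : τ.IsRelational) (hσ : σ.IsRelational) {x : Word} (hx : Valid e x)
    [Sσ : σ.Structure (Fin (lead x))]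
    (hS : ∀ {r} (R : σ.Relations r) (ts : Fin r → Fin (lead x)),
      Sσ.RelMap R ts ↔ (decodeStructure e hτ x (lead x)).RelMap (prime r R) ts)
    {l : ℕ} (φ : (τ.sum σ).BoundedFormula Empty l) (O : Set Word) (ts : Fin l → Fin (lead x)) :
    (translate e prime φ).holds O x ts ↔
      let _ := decodeStructure e hτ x (lead x)
      φ.Realize Empty.elim ts := by
  let _ := decodeStructure e hτ x (lead x)
  have hL : (τ.sum σ).IsRelational := fun n => ⟨fun f => f.elim (hτ n).false (hσ n).false⟩
  obtain ⟨ht, hf⟩ := lead_eq_iff.1 (rfl : lead x = lead x)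
  induction φ with
  | falsum => simp [translate, FirstOrder.Language.BoundedFormula.Realize]
  | equal t u =>
    obtain ⟨i, rfl⟩ := exists_term_eq_var hL t
    obtain ⟨j, rfl⟩ := exists_term_eq_var hL u
    have hlen : lead x < x.length := by have := hx.2; omega
    rw [List.getElem?_eq_getElem hlen] at hf
    have h0 : x[lead x]? = some false := by
      rw [List.getElem?_eq_getElem hlen]
      simpa using hf
    have hpos : ∀ i j : ℕ, posVal (Counter.val (lead x) (tupleVal (fun j => (j : ℕ)) ts)
        (tupleVal (fun j => lead x - (j : ℕ)) ts)) [[.var i], [.cov j]] =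
        tupleVal (fun j => (j : ℕ)) ts i + tupleVal (fun j => lead x - (j : ℕ)) ts j := by
      intro i j; simp [posVal, Counter.val]
    simp only [translate, Fml.holds_and]
    simp only [Fml.holds, Fml.val, hpos, varIndex, beq_iff_eq]
    have h1 : ∀ i : Fin _, tupleVal (fun j => (j : ℕ)) ts i = ts i := by intro i; simp [tupleVal]
    have h2 : ∀ i : Fin _, tupleVal (fun j => lead x - (j : ℕ)) ts i = lead x - ts i := by
      intro i; simp [tupleVal]
    rw [h1, h1, h2, h2]
    simp only [FirstOrder.Language.BoundedFormula.Realize, FirstOrder.Language.Term.realize_var,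
      Sum.elim_inr]
    constructor
    · rintro ⟨h3, h4⟩
      by_contra hne
      have hne' : (ts i : ℕ) ≠ ts j := fun h => hne (Fin.ext h)
      have hi := (ts i).2
      have hj := (ts j).2
      rcases lt_or_gt_of_ne hne' with h | h
      · rw [ht _ (by omega)] at h3
        simp at h3
      · rw [ht _ (by omega)] at h4
        simp at h4
    · intro h
      rw [h, show (ts j : ℕ) + (lead x - ts j) = lead x by have := (ts j).2; omega]
      exact ⟨h0, h0⟩
  | @rel l r R us =>
    choose vs hvs using fun i => exists_term_eq_var hL (us i)
    have h1 : (fun i => varIndex (us i)) = fun i => (vs i : ℕ) := by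
      funext i; rw [hvs]; rfl
    have h2 : (fun i => (us i).realize (Sum.elim Empty.elim ts)) = ts ∘ vs := by
      funext i; rw [hvs]; rfl
    simp only [translate, Fml.holds, Fml.val, h1, beq_iff_eq]
    rw [posVal_atomPos e ⟨r, Sum.elim id (prime r) R⟩ vs ts]
    simp only [FirstOrder.Language.BoundedFormula.Realize, h2]
    rcases R with R | R
    · exact Iff.rfl
    · exact (hS R _).symm
  | imp φ ψ ih ih' =>
    simp only [translate, Fml.holds_ite, ih, ih', Fml.holds_const,
      FirstOrder.Language.BoundedFormula.Realize]
    tauto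
  | all φ ih =>
    simp only [translate, Fml.holds_all, ih, FirstOrder.Language.BoundedFormula.Realize]

end Encoding

/-! ### Extensional sentences -/

theorem realize_iff_of_not_occurs {L : FirstOrder.Language.{0, 0}} (hL : L.IsRelational)
    {M : Type} (S S' : L.Structure M) {s : Σ r, L.Relations r}
    (h : ∀ {r} (R : L.Relations r) (ts : Fin r → M), s ≠ ⟨r, R⟩ →
      (S.RelMap R ts ↔ S'.RelMap R ts)) {α : Type} {l : ℕ} (φ : L.BoundedFormula α l)
    (hφ : ¬ Occurs s φ) (v : α → M) (xs : Fin l → M) :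
    @FirstOrder.Language.BoundedFormula.Realize L M S α l φ v xs ↔
      @FirstOrder.Language.BoundedFormula.Realize L M S' α l φ v xs := by
  have hterm : ∀ {β : Type} (t : L.Term β) (w : β → M),
      @FirstOrder.Language.Term.realize L M S β w t =
        @FirstOrder.Language.Term.realize L M S' β w t := by
    intro β t w
    rcases t with i | ⟨f, _⟩
    · rfl
    · exact ((hL _).false f).elim
  induction φ with
  | falsum => exact Iff.rfl
  | equal t u =>
    simp only [FirstOrder.Language.BoundedFormula.Realize, hterm]
  | rel R ts =>
    simp only [FirstOrder.Language.BoundedFormula.Realize, hterm]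
    exact h R _ hφ
  | imp φ ψ ih ih' =>
    simp only [Occurs, not_or] at hφ
    simp only [FirstOrder.Language.BoundedFormula.Realize, ih hφ.1, ih' hφ.2]
  | all φ ih =>
    simp only [FirstOrder.Language.BoundedFormula.Realize, ih hφ]

section

variable {τ : FirstOrder.Language.{0, 0}}

/-- The expansion of the `τ`-structure `S` by the `σ`-structure `T` satisfies the first-order part
of `Ψ`. -/
def ESOSentence.Models (Ψ : ESOSentence τ) {M : Type} (S : τ.Structure M)
    (T : Ψ.σ.Structure M) : Prop :=
  ∀ φ ∈ Ψ.conjuncts, @FirstOrder.Language.Sentence.Realize (τ.sum Ψ.σ) M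
    (@FirstOrder.Language.sumStructure τ Ψ.σ M S T) φ

theorem realize_extensionConjunct {σ : FirstOrder.Language.{0, 0}} {M : Type} (S : τ.Structure M)
    (T : σ.Structure M) {r : ℕ} (R' : τ.Relations r) (R : σ.Relations r) :
    @FirstOrder.Language.Sentence.Realize (τ.sum σ) M
      (@FirstOrder.Language.sumStructure τ σ M S T) (extensionConjunct R' R) ↔
      ∀ ts : Fin r → M, S.RelMap R' ts → T.RelMap R ts := by
  exact FirstOrder.Language.BoundedFormula.realize_alls

variable {Ψ : ESOSentence τ} {prime : ∀ r, Ψ.σ.Relations r → τ.Relations r}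

/-- The structure in which the quantified symbols are interpreted like the symbols that they
extend. -/
@[reducible] def primeStructure (Ψ : ESOSentence τ)
    (prime : ∀ r, Ψ.σ.Relations r → τ.Relations r) {M : Type} (S : τ.Structure M) : Ψ.σ.Structure M where
  funMap f := ((Ψ.relational _).false f).elim
  RelMap R ts := S.RelMap (prime _ R) ts

/-- The use of extensionality: the partner of `R` is visible only in its extension conjunct, so its
relation may be changed freely as long as it stays inside the interpretation of `R` in `T`. -/
theorem ESOSentence.Models.congr (hτ : τ.IsRelational)
    (hprime : ∀ (r : ℕ) (R : Ψ.σ.Relations r), extensionConjunct (prime r R) R ∈ Ψ.conjuncts ∧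
      ∀ φ ∈ Ψ.conjuncts, φ ≠ extensionConjunct (prime r R) R →
        ¬ Occurs (L := τ.sum Ψ.σ) ⟨r, Sum.inl (prime r R)⟩ φ)
    {M : Type} {S S' : τ.Structure M} {T : Ψ.σ.Structure M} (h : Ψ.Models S T) {r : ℕ}
    (R : Ψ.σ.Relations r)
    (hne : ∀ {r'} (R' : τ.Relations r') (ts : Fin r' → M),
      (⟨r, prime r R⟩ : Σ r, τ.Relations r) ≠ ⟨r', R'⟩ → (S.RelMap R' ts ↔ S'.RelMap R' ts))
    (hR : ∀ ts, S'.RelMap (prime r R) ts → T.RelMap R ts) : Ψ.Models S' T := by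
  intro φ hφ
  by_cases h' : φ = extensionConjunct (prime r R) R
  · subst h'
    exact (realize_extensionConjunct S' T _ _).2 hR
  · have hL : (τ.sum Ψ.σ).IsRelational :=
      fun n => ⟨fun f => f.elim (hτ n).false (Ψ.relational n).false⟩
    refine (realize_iff_of_not_occurs hL (@FirstOrder.Language.sumStructure τ Ψ.σ M S T)
      (@FirstOrder.Language.sumStructure τ Ψ.σ M S' T) ?_ φ ((hprime r R).2 φ hφ h') _ _).1 (h φ hφ)
    intro r' R' ts hs
    rcases R' with R' | R'
    · refine hne R' ts fun heq => hs ?_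
      obtain ⟨rfl, h2⟩ := Sigma.mk.inj_iff.1 heq
      obtain rfl := eq_of_heq h2
      rfl
    · exact Iff.rfl

/-- An extensional sentence that is not satisfied by the smallest extensions is satisfied if and
only if it is satisfied after the addition of some tuple. -/
theorem exists_models_iff (hτ : τ.IsRelational)
    (hprime : ∀ (r : ℕ) (R : Ψ.σ.Relations r), extensionConjunct (prime r R) R ∈ Ψ.conjuncts ∧
      ∀ φ ∈ Ψ.conjuncts, φ ≠ extensionConjunct (prime r R) R →
        ¬ Occurs (L := τ.sum Ψ.σ) ⟨r, Sum.inl (prime r R)⟩ φ)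
    {M : Type} {S : τ.Structure M} (hS : ¬ Ψ.Models S (primeStructure Ψ prime S))
    (S' : ∀ {r}, Ψ.σ.Relations r → (Fin r → M) → τ.Structure M)
    (hS' : ∀ {r} (R : Ψ.σ.Relations r) (ts : Fin r → M) {r'} (R' : τ.Relations r')
      (ts' : Fin r' → M), (S' R ts).RelMap R' ts' ↔ S.RelMap R' ts' ∨
        ∃ h : r = r', h ▸ prime r R = R' ∧ ts = ts' ∘ Fin.cast h) :
    (∃ T, Ψ.Models S T) ↔ ∃ (r : ℕ) (R : Ψ.σ.Relations r) (ts : Fin r → M),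
      ¬ S.RelMap (prime r R) ts ∧ ∃ T, Ψ.Models (S' R ts) T := by
  have hne : ∀ {r} (R : Ψ.σ.Relations r) (ts : Fin r → M) {r'} (R' : τ.Relations r')
      (ts' : Fin r' → M), (⟨r, prime r R⟩ : Σ r, τ.Relations r) ≠ ⟨r', R'⟩ →
      (S.RelMap R' ts' ↔ (S' R ts).RelMap R' ts') := by
    intro r R ts r' R' ts' hs
    rw [hS']
    refine ⟨Or.inl, ?_⟩
    rintro (h | ⟨rfl, rfl, _⟩)
    · exact h
    · exact (hs rfl).elim
  constructor
  · rintro ⟨T, hT⟩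
    have hext : ∀ {r} (R : Ψ.σ.Relations r) (ts : Fin r → M),
        S.RelMap (prime r R) ts → T.RelMap R ts := fun R ts =>
      (realize_extensionConjunct S T _ _).1 (hT _ (hprime _ R).1) ts
    -- A witness contains the smallest candidate; if it had no further tuple, it would equal this
    -- candidate, which is not a witness by `hS`.
    have : ∃ (r : ℕ) (R : Ψ.σ.Relations r) (ts : Fin r → M), ¬ S.RelMap (prime r R) ts ∧
        T.RelMap R ts := by
      by_contra! hcon
      refine hS ?_
      have : primeStructure Ψ prime S = T := by
        refine FirstOrder.Language.Structure.ext ?_ ?_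
        · funext m f
          exact ((Ψ.relational m).false f).elim
        · funext r R ts
          refine propext ⟨hext R ts, fun h => ?_⟩
          by_contra h'
          exact hcon r R ts h' h
      rwa [this]
    obtain ⟨r, R, ts, h1, h2⟩ := this
    -- The same `T` works, because the added tuple already belongs to it.
    refine ⟨r, R, ts, h1, T, hT.congr hτ hprime R (hne R ts) fun ts' h => ?_⟩
    rcases (hS' R ts _ ts').1 h with h | ⟨_, _, rfl⟩
    · exact hext R ts' h
    · exact h2
  · rintro ⟨r, R, ts, _, T, hT⟩
    -- Removing the tuple from the partner only weakens the extension conjunct.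
    refine ⟨T, hT.congr hτ hprime R (fun R' ts' h => (hne R ts R' ts' h).symm) fun ts' h => ?_⟩
    exact (realize_extensionConjunct _ T _ _).1 (hT _ (hprime _ R).1) ts'
      ((hS' R ts _ ts').2 (Or.inl h))

end

/-! ### The self-reduction as a formula -/

section

variable {τ : FirstOrder.Language.{0, 0}} {k : ℕ} (e : Fin k ≃ Σ r, τ.Relations r)
  (Ψ : ESOSentence τ) (prime : ∀ r, Ψ.σ.Relations r → τ.Relations r)

/-- The list of the quantified symbols. -/
noncomputable def ESOSentence.symbols : List (Σ r, Ψ.σ.Relations r) :=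
  haveI := Ψ.finite
  (Fintype.ofFinite (Σ r, Ψ.σ.Relations r)).elems.toList

theorem ESOSentence.mem_symbols (s : Σ r, Ψ.σ.Relations r) : s ∈ Ψ.symbols := by
  have := Ψ.finite
  exact Finset.mem_toList.2 ((Fintype.ofFinite (Σ r, Ψ.σ.Relations r)).complete s)

/-- The formula that describes the self-reduction. -/
noncomputable def reductionFml : Fml 0 :=
  .ite (validFml e)
    (.ite (.conj (Ψ.conjuncts.map (translate e prime))) (.const true)
      -- The disjunction over all symbols and tuples, written with negations so that every part is
      -- evaluated and every query is asked even after a positive answer.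
      (.not (.conj (Ψ.symbols.map fun s =>
        .alls (.not (.ask (l := s.1) (atomPos e ⟨s.1, prime s.1 s.2⟩ fun i => i)))))))
    (.const false)

/-- The word obtained from `x` by adding a tuple to a relation. -/
def addTuple (x : Word) {r : ℕ} (R : Ψ.σ.Relations r) (ts : Fin r → Fin (lead x)) : Word :=
  x.set (relPos e (lead x) (e.symm ⟨r, prime r R⟩) (finFunctionFinEquiv ts)) true

variable (hτ : τ.IsRelational) {Ψ prime}

/-- The word `x` encodes a structure that satisfies the first-order part of `Ψ` with the smallest
extensions. -/
def Base (Ψ : ESOSentence τ) (prime : ∀ r, Ψ.σ.Relations r → τ.Relations r) (x : Word) : Prop :=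
  Ψ.Models (decodeStructure e hτ x (lead x))
    (primeStructure Ψ prime (decodeStructure e hτ x (lead x)))

/-- In a valid word the position lies inside the word, so a letter that is not a one is a zero.
Hence the guard of `ask` lets through exactly the missing tuples. -/
theorem getElem?_relPos_eq_false {x : Word} (hx : Valid e x) {r : ℕ} (R : τ.Relations r)
    (ts : Fin r → Fin (lead x)) :
    x[relPos e (lead x) (e.symm ⟨r, R⟩) (finFunctionFinEquiv ts)]? = some false ↔
      ¬ (decodeStructure e hτ x (lead x)).RelMap R ts := by
  have hpos : ∀ (s : Σ r, τ.Relations r) (us : Fin s.1 → Fin (lead x)),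
      (finFunctionFinEquiv us : ℕ) < lead x ^ (e ⟨e.symm s, (e.symm s).2⟩).1 := by
    intro s us
    obtain ⟨i, rfl⟩ := e.surjective s
    simpa using (finFunctionFinEquiv us).2
  have hlt := relPos_lt e (e.symm ⟨r, R⟩).2 (hpos ⟨r, R⟩ ts)
  rw [← hx.2] at hlt
  rw [relMap_decodeStructure, List.getElem?_eq_getElem hlt]
  simp

variable {O : Set Word} {x : Word} (us : Fin 0 → Fin (lead x))

theorem holds_base (hx : Valid e x) :
    (Fml.conj (Ψ.conjuncts.map (translate e prime))).holds O x us ↔ Base e hτ Ψ prime x := by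
  rw [Fml.holds_conj]
  simp only [List.mem_map, forall_exists_index, and_imp, forall_apply_eq_imp_iff₂]
  refine forall₂_congr fun φ _ => ?_
  let _ := primeStructure Ψ prime (decodeStructure e hτ x (lead x))
  rw [holds_translate e prime hτ Ψ.relational hx (fun _ _ => Iff.rfl)]
  rw [Subsingleton.elim us default, Subsingleton.elim Empty.elim default]
  rfl

theorem holds_ask (hx : Valid e x) {r : ℕ} (R : Ψ.σ.Relations r) (ts : Fin r → Fin (lead x)) :
    (Fml.ask (l := r) (atomPos e ⟨r, prime r R⟩ fun i => i)).holds O x ts ↔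
      ¬ (decodeStructure e hτ x (lead x)).RelMap (prime r R) ts ∧
        addTuple e Ψ prime x R ts ∈ O := by
  simp only [Fml.holds, Fml.val]
  rw [posVal_atomPos e ⟨r, prime r R⟩ (fun i => i) ts]
  simp only [decide_eq_true_eq]
  rw [← getElem?_relPos_eq_false e hτ hx]
  rfl

open Classical in
theorem queries_ask (hx : Valid e x) {r : ℕ} (R : Ψ.σ.Relations r) (ts : Fin r → Fin (lead x)) :
    (Fml.ask (l := r) (atomPos e ⟨r, prime r R⟩ fun i => i)).queries O x ts =
      if ¬ (decodeStructure e hτ x (lead x)).RelMap (prime r R) ts then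
        [addTuple e Ψ prime x R ts] else [] := by
  simp only [Fml.queries, Fml.asks]
  rw [posVal_atomPos e ⟨r, prime r R⟩ (fun i => i) ts]
  simp only [← getElem?_relPos_eq_false e hτ hx]
  rfl

theorem holds_reductionFml (hx : Valid e x) : (reductionFml e Ψ prime).holds O x us ↔
    Base e hτ Ψ prime x ∨ ∃ (r : ℕ) (R : Ψ.σ.Relations r) (ts : Fin r → Fin (lead x)),
      ¬ (decodeStructure e hτ x (lead x)).RelMap (prime r R) ts ∧
        addTuple e Ψ prime x R ts ∈ O := by
  simp only [reductionFml, Fml.holds_ite, holds_base e hτ us hx, holds_validFml, hx, true_and,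
    not_true_eq_false, false_and, or_false, Fml.holds_const, and_true, Fml.holds_not,
    Fml.holds_conj, List.mem_map, forall_exists_index, and_imp, forall_apply_eq_imp_iff₂,
    Fml.holds_alls, holds_ask e hτ hx]
  have : (¬ ∀ s ∈ Ψ.symbols, ∀ ts : Fin s.1 → Fin (lead x),
      ¬ (¬ (decodeStructure e hτ x (lead x)).RelMap (prime s.1 s.2) ts ∧
        addTuple e Ψ prime x s.2 ts ∈ O)) ↔ ∃ (r : ℕ) (R : Ψ.σ.Relations r)
      (ts : Fin r → Fin (lead x)), ¬ (decodeStructure e hτ x (lead x)).RelMap (prime r R) ts ∧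
        addTuple e Ψ prime x R ts ∈ O := by
    push Not
    exact ⟨fun ⟨s, _, ts, h⟩ => ⟨s.1, s.2, ts, h⟩,
      fun ⟨r, R, ts, h⟩ => ⟨⟨r, R⟩, Ψ.mem_symbols _, ts, h⟩⟩
  rw [this]
  tauto

open Classical in
theorem queries_reductionFml (hx : Valid e x) : (reductionFml e Ψ prime).queries O x us =
    if Base e hτ Ψ prime x then [] else Ψ.symbols.flatMap fun s =>
      (Fml.alls (.not (.ask (l := s.1) (atomPos e ⟨s.1, prime s.1 s.2⟩ fun i => i)))).queries
        O x us := by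
  have h0 : (Fml.conj (Ψ.conjuncts.map (translate e prime))).queries O x us = [] := by
    simp [queries_translate]
  have h1 := (holds_validFml e O x us).2 hx
  have h2 := holds_base e hτ (O := O) (Ψ := Ψ) (prime := prime) us hx
  rw [reductionFml, Fml.queries_ite, if_pos h1, queries_validFml, List.nil_append, Fml.queries_ite,
    h0, List.nil_append]
  by_cases hb : Base e hτ Ψ prime x
  · rw [if_pos hb, if_pos (h2.2 hb), Fml.queries_const]
  · rw [if_neg hb, if_neg (fun h => hb (h2.1 h)), Fml.queries_not, Fml.queries_conj,
      List.flatMap_map]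

theorem mem_queries_reductionFml (hx : Valid e x) (w : Word) :
    w ∈ (reductionFml e Ψ prime).queries O x us ↔ ¬ Base e hτ Ψ prime x ∧
      ∃ (r : ℕ) (R : Ψ.σ.Relations r) (ts : Fin r → Fin (lead x)),
      ¬ (decodeStructure e hτ x (lead x)).RelMap (prime r R) ts ∧
        w = addTuple e Ψ prime x R ts := by
  rw [queries_reductionFml e hτ us hx]
  by_cases hb : Base e hτ Ψ prime x
  · simp [hb]
  · rw [if_neg hb]
    simp only [hb, not_false_eq_true, true_and, List.mem_flatMap,
      Fml.mem_queries_alls, Fml.queries_not, queries_ask e hτ hx]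
    constructor
    · rintro ⟨s, _, ts, h⟩
      refine ⟨s.1, s.2, ts, ?_⟩
      by_cases h' : (decodeStructure e hτ x (lead x)).RelMap (prime s.1 s.2) ts
      · simp [h'] at h
      · exact ⟨h', by simpa [h'] using h⟩
    · rintro ⟨r, R, ts, h, rfl⟩
      exact ⟨⟨r, R⟩, Ψ.mem_symbols _, ts, by simp [h]⟩

/-- Whether queries are made is decided by `Base`, which does not involve the oracle; which ones are
made depends only on the missing tuples. -/
theorem queries_reductionFml_congr (hrel : τ.IsRelational) (O' : Set Word) (hx : Valid e x) :
    (reductionFml e Ψ prime).queries O x us = (reductionFml e Ψ prime).queries O' x us := by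
  rw [queries_reductionFml e hrel us hx, queries_reductionFml e hrel us hx]
  congr 2
  funext s
  refine Fml.queries_alls_congr _ _ fun ts => ?_
  rw [Fml.queries_not, Fml.queries_not, queries_ask e hrel hx, queries_ask e hrel hx]

theorem reductionFml_of_not_valid (hx : ¬ Valid e x) :
    ¬ (reductionFml e Ψ prime).holds O x us ∧ (reductionFml e Ψ prime).queries O x us = [] := by
  have h1 : ¬ (validFml e).holds O x us := fun h => hx ((holds_validFml e O x us).1 h)
  constructor
  · rw [reductionFml, Fml.holds_ite]
    simp only [h1, false_and, not_false_eq_true, Fml.holds_const, false_or]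
    simp
  · rw [reductionFml, Fml.queries_ite, if_neg h1, queries_validFml, Fml.queries_const]
    rfl

end

/-! ### The partial order -/

/-- The word `y` is obtained from `x` by replacing some zeros by ones. -/
def MoreOnes (y x : Word) : Prop := List.Forall₂ (fun b c : Bool => c ≤ b) y x ∧ y ≠ x

/-- The number of ones is a strictly monotone measure for `MoreOnes`. It gives both antisymmetry and
the bound on chains. -/
theorem count_of_forall₂ {y x : Word} (h : List.Forall₂ (fun b c : Bool => c ≤ b) y x) :
    x.count true ≤ y.count true ∧ (x.count true = y.count true → y = x) := by
  induction h with
  | nil => simp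
  | @cons b c y x hbc _ ih =>
    cases b <;> cases c
    · simpa using ih
    · exact absurd hbc (by decide)
    · simp
      exact ⟨by omega, by intro h; omega⟩
    · simpa using ih

theorem MoreOnes.length_eq {y x : Word} (h : MoreOnes y x) : y.length = x.length :=
  h.1.length_eq

theorem MoreOnes.count_lt {y x : Word} (h : MoreOnes y x) : x.count true < y.count true :=
  lt_of_le_of_ne (count_of_forall₂ h.1).1 fun he => h.2 ((count_of_forall₂ h.1).2 he)

theorem MoreOnes.trans {z y x : Word} (h : MoreOnes z y) (h' : MoreOnes y x) : MoreOnes z x := by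
  refine ⟨?_, ?_⟩
  · obtain ⟨h1, h2⟩ := List.forall₂_iff_get.1 h.1
    obtain ⟨h3, h4⟩ := List.forall₂_iff_get.1 h'.1
    exact List.forall₂_iff_get.2 ⟨h1.trans h3, fun i hi hi' =>
      (h4 i (h1 ▸ hi) hi').trans (h2 i hi (h1 ▸ hi))⟩
  · rintro rfl
    exact lt_asymm h.count_lt h'.count_lt

theorem moreOnes_set {x : Word} {p : ℕ} (hp : x[p]? = some false) :
    MoreOnes (x.set p true) x := by
  obtain ⟨hlt, hget⟩ := List.getElem?_eq_some_iff.1 hp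
  refine ⟨List.forall₂_iff_get.2 ⟨by simp, fun i h h' => ?_⟩, fun h => ?_⟩
  · simp only [List.get_eq_getElem, List.getElem_set]
    split_ifs <;> simp
  · have : (x.set p true)[p]? = x[p]? := by rw [h]
    rw [hp, List.getElem?_set_self hlt] at this
    simp at this

/-- The numbers of ones are pairwise distinct and lie in `{0, …, n}`. -/
theorem length_le_of_pairwise_moreOnes {l : List Word} {n : ℕ} (hl : l.Pairwise MoreOnes)
    (hn : ∀ w ∈ l, w.length = n) : l.length ≤ n + 1 := by
  have h1 : (l.map (List.count true)).Pairwise (· > ·) :=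
    List.pairwise_map.2 (hl.imp fun h => h.count_lt)
  have h2 : (l.map (List.count true)).toFinset ⊆ Finset.range (n + 1) := by
    intro m hm
    obtain ⟨w, hw, rfl⟩ := List.mem_map.1 (List.mem_toFinset.1 hm)
    rw [Finset.mem_range, Nat.lt_succ_iff, ← hn w hw]
    exact List.count_le_length
  have h3 := Finset.card_le_card h2
  rwa [List.toFinset_card_of_nodup (h1.imp fun h => h.ne'), List.length_map,
    Finset.card_range] at h3

/-! ### A polynomial-time machine that decides the order -/

/-- The stacks of the machine that compares two words. -/
inductive CompStack
  | inp
  | fst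
  | snd
  deriving DecidableEq

instance : Fintype CompStack := ⟨{.inp, .fst, .snd}, fun k => by cases k <;> decide⟩

/-- The alphabets of the machine that compares two words. -/
@[reducible] def CompStack.Alphabet : CompStack → Type
  | inp => Bool ⊕ Bool
  | fst => Bool
  | snd => Bool

/-- The internal states of the machine that compares two words: the letters that have been read,
whether the comparison is successful so far, and whether the words are different so far. -/
abbrev CompState : Type := Option (Bool ⊕ Bool) × Option Bool × Option Bool × Bool × Bool

/-- Compare two letters. -/
def CompState.update : CompState → CompState
  | (_, some b, some c, ok, ne) => (none, none, none, ok && decide (c ≤ b), ne || b != c)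
  -- One word ended before the other. The first flag can never become true again, so the answer is
  -- negative.
  | (_, _, _, _, _) => (none, none, none, false, false)

/-- The statements of the machine that compares two words: at the label `false`, it distributes
the input to two stacks, and at the label `true` it compares these stacks. -/
def compStmt : Bool → TM2.Stmt CompStack.Alphabet Bool CompState
  | false => .pop .inp (fun v o => (o, v.2)) (.branch (fun v => v.1.isNone) (.goto fun _ => true)
      (.branch (fun v => v.1.any Sum.isLeft)
        (.push .fst (fun v => (v.1.bind Sum.getLeft?).getD false) (.goto fun _ => false))
        (.push .snd (fun v => (v.1.bind Sum.getRight?).getD false) (.goto fun _ => false))))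
  | true => .pop .fst (fun v o => (none, o, v.2.2)) (.pop .snd (fun v o => (none, v.2.1, o, v.2.2.2))
      (.branch (fun v => v.2.1.isNone && v.2.2.1.isNone)
        (.push .fst (fun v => v.2.2.2.1 && v.2.2.2.2) (.load (fun _ => (none, none, none, true, false))
          .halt))
        (.load CompState.update (.goto fun _ => true))))

/-- The machine that compares two words. -/
def compMachine : FinTM2 where
  K := CompStack
  k₀ := .inp
  k₁ := .fst
  Γ := CompStack.Alphabet
  Λ := Bool
  main := false
  σ := CompState
  initialState := (none, none, none, true, false)
  Γk₀Fin := inferInstanceAs (Fintype (Bool ⊕ Bool))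
  m := compStmt

/-- The contents of the stacks of the machine that compares two words. -/
def compStk (i : List (Bool ⊕ Bool)) (a b : Word) : ∀ k : CompStack, List k.Alphabet
  | .inp => i
  | .fst => a
  | .snd => b

theorem compStk_update_inp (i i' : List (Bool ⊕ Bool)) (a b : Word) :
    Function.update (compStk i a b) .inp i' = compStk i' a b := by
  funext k; cases k <;> rfl

theorem compStk_update_fst (i : List (Bool ⊕ Bool)) (a a' b : Word) :
    Function.update (compStk i a b) .fst a' = compStk i a' b := by
  funext k; cases k <;> rfl

theorem compStk_update_snd (i : List (Bool ⊕ Bool)) (a b b' : Word) :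
    Function.update (compStk i a b) .snd b' = compStk i a b' := by
  funext k; cases k <;> rfl

/-- A configuration of the machine that compares two words. -/
def compCfg (l : Option Bool) (v : CompState) (i : List (Bool ⊕ Bool)) (a b : Word) :
    compMachine.Cfg := ⟨l, v, compStk i a b⟩

theorem comp_step (l : Bool) (v : CompState) (i : List (Bool ⊕ Bool)) (a b : Word) :
    compMachine.step (compCfg (some l) v i a b) =
      some (TM2.stepAux (compStmt l) v (compStk i a b)) := rfl

/-- Both words arrive reversed on their stacks, which is harmless because a letterwise comparison is
invariant under reversing both words. -/
theorem comp_read (i : List (Bool ⊕ Bool)) (v : CompState) (a b : Word) : ∃ o,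
    Nonempty (EvalsToInTime compMachine.step (compCfg (some false) v i a b)
      (some (compCfg (some true) (o, v.2) [] ((i.filterMap Sum.getLeft?).reverse ++ a)
        ((i.filterMap Sum.getRight?).reverse ++ b))) (i.length + 1)) := by
  induction i generalizing v a b with
  | nil =>
    refine ⟨none, evalsToInTime_one ?_⟩
    rw [comp_step]
    simp only [compStmt, TM2.stepAux]
    rw [show compStk [] a b .inp = [] from rfl]
    simp only [List.head?_nil, List.tail_nil, Option.isNone_none, cond_true, compStk_update_inp]
    rfl
  | cons s i ih =>
    cases s with
    | inl c =>
      obtain ⟨o, ho⟩ := ih (some (Sum.inl c), v.2) (c :: a) b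
      refine ⟨o, evalsToInTime_mono (evalsToInTime_trans (evalsToInTime_one
        (x := some (compCfg (some false) (some (Sum.inl c), v.2) i (c :: a) b)) ?_)
        (t := i.length + 1) ?_) (by simp; omega)⟩
      · rw [comp_step]
        simp only [compStmt, TM2.stepAux]
        rw [show compStk (Sum.inl c :: i) a b .inp = Sum.inl c :: i from rfl]
        simp only [List.head?_cons, List.tail_cons, Option.isNone_some, cond_false,
          compStk_update_inp]
        rw [show compStk i a b .fst = a from rfl]
        simp only [compStk_update_fst]
        rfl
      · simpa [List.filterMap_cons] using ho
    | inr c =>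
      obtain ⟨o, ho⟩ := ih (some (Sum.inr c), v.2) a (c :: b)
      refine ⟨o, evalsToInTime_mono (evalsToInTime_trans (evalsToInTime_one
        (x := some (compCfg (some false) (some (Sum.inr c), v.2) i a (c :: b))) ?_)
        (t := i.length + 1) ?_) (by simp; omega)⟩
      · rw [comp_step]
        simp only [compStmt, TM2.stepAux]
        rw [show compStk (Sum.inr c :: i) a b .inp = Sum.inr c :: i from rfl]
        simp only [List.head?_cons, List.tail_cons, Option.isNone_some, cond_false,
          compStk_update_inp]
        rw [show compStk i a b .snd = b from rfl]
        simp only [compStk_update_snd]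
        rfl
      · simpa [List.filterMap_cons] using ho

theorem comp_done (o : Option (Bool ⊕ Bool)) (o₁ o₂ : Option Bool) (ok ne : Bool) :
    compMachine.step (compCfg (some true) (o, o₁, o₂, ok, ne) [] [] []) =
      some (compCfg none (none, none, none, true, false) [] [ok && ne] []) := by
  rw [comp_step]
  simp only [compStmt, TM2.stepAux]
  rw [show compStk [] [] [] .fst = [] from rfl]
  simp only [List.head?_nil, List.tail_nil, compStk_update_fst]
  rw [show compStk [] [] [] .snd = [] from rfl]
  simp only [List.head?_nil, List.tail_nil, compStk_update_snd, Option.isNone_none, Bool.and_self,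
    cond_true]
  rw [show compStk [] [] [] .fst = [] from rfl, compStk_update_fst]
  rfl

theorem comp_next (v : CompState) (a b : Word) (h : a ≠ [] ∨ b ≠ []) :
    compMachine.step (compCfg (some true) v [] a b) =
      some (compCfg (some true) (CompState.update (none, a.head?, b.head?, v.2.2.2)) []
        a.tail b.tail) := by
  rw [comp_step]
  simp only [compStmt, TM2.stepAux]
  rw [show compStk [] a b .fst = a from rfl]
  simp only [compStk_update_fst]
  rw [show compStk [] a.tail b .snd = b from rfl]
  simp only [compStk_update_snd]
  have : (a.head?.isNone && b.head?.isNone) = false := by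
    cases a <;> cases b <;> simp at h ⊢
  rw [this]
  rfl

-- The flags `ok` and `ne` summarize the letters already consumed. The induction is on a bound for
-- the total length, since the two words may have different lengths.
open Classical in
theorem comp_compare (n : ℕ) (o : Option (Bool ⊕ Bool)) (o₁ o₂ : Option Bool) (ok ne : Bool)
    (a b : Word) (hn : a.length + b.length ≤ n) :
    Nonempty (EvalsToInTime compMachine.step (compCfg (some true) (o, o₁, o₂, ok, ne) [] a b)
      (some (compCfg none (none, none, none, true, false) [] [decide (ok = true ∧
        List.Forall₂ (fun b c : Bool => c ≤ b) a b ∧ (ne = true ∨ a ≠ b))] [])) (n + 1)) := by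
  induction n generalizing o o₁ o₂ ok ne a b with
  | zero =>
    obtain rfl : a = [] := List.eq_nil_of_length_eq_zero (by omega)
    obtain rfl : b = [] := List.eq_nil_of_length_eq_zero (by omega)
    refine evalsToInTime_one ?_
    rw [comp_done]
    cases ok <;> cases ne <;> simp
  | succ n ih =>
    by_cases h : a ≠ [] ∨ b ≠ []
    · have h1 := evalsToInTime_one (comp_next (o, o₁, o₂, ok, ne) a b h)
      have hlen : a.tail.length + b.tail.length ≤ n := by
        cases a <;> cases b <;> simp at h hn ⊢ <;> omega
      refine evalsToInTime_mono (evalsToInTime_trans (t := n + 1) h1 ?_) (by omega)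
      rcases a with _ | ⟨c, a⟩ <;> rcases b with _ | ⟨d, b⟩
      · simp at h
      · simpa [CompState.update] using ih none none none false false [] b hlen
      · simpa [CompState.update] using ih none none none false false a [] hlen
      · have h2 := ih none none none (ok && decide (d ≤ c)) (ne || c != d) a b hlen
        have h3 : (ok = true ∧ List.Forall₂ (fun b c : Bool => c ≤ b) (c :: a) (d :: b) ∧
            (ne = true ∨ c :: a ≠ d :: b)) ↔ ((ok && decide (d ≤ c)) = true ∧
            List.Forall₂ (fun b c : Bool => c ≤ b) a b ∧ ((ne || c != d) = true ∨ a ≠ b)) := by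
          simp only [List.forall₂_cons, ne_eq, List.cons.injEq, Bool.and_eq_true,
            decide_eq_true_eq, Bool.or_eq_true, bne_iff_ne]
          tauto
        simp only [h3]
        exact h2
    · obtain ⟨rfl, rfl⟩ : a = [] ∧ b = [] := by push Not at h; exact h
      exact evalsToInTime_mono (ih o o₁ o₂ ok ne [] [] (by simp)) (by omega)

open Classical in
theorem polyTimeDecidable_moreOnes : PolyTimeDecidable MoreOnes := by
  refine ⟨fun q => decide (MoreOnes q.1 q.2), by simp, ?_⟩
  refine ⟨{
    tm := compMachine
    inputAlphabet := Equiv.refl _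
    outputAlphabet := Equiv.refl _
    -- At most `|i| + 1` steps for distributing the input and as many for comparing the two words.
    time := 2 * Polynomial.X + 2
    outputsFun := fun q => Classical.choice ?_ }⟩
  obtain ⟨x, y⟩ := q
  set i : List (Bool ⊕ Bool) := (Computability.encodingProd (Computability.encodingList Bool)
    (Computability.encodingList Bool)).encode (x, y) with hi
  have hi' : i = x.map Sum.inl ++ y.map Sum.inr := rfl
  obtain ⟨o, h1⟩ := comp_read i (none, none, none, true, false) [] []
  have e1 : i.filterMap Sum.getLeft? = x := by
    simp [hi', List.filterMap_append, List.filterMap_map, Function.comp_def]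
  have e2 : i.filterMap Sum.getRight? = y := by
    simp [hi', List.filterMap_append, List.filterMap_map, Function.comp_def]
  rw [e1, e2, List.append_nil, List.append_nil] at h1
  have h2 := comp_compare i.length o none none true false x.reverse y.reverse (by simp [hi'])
  have e3 : (true = true ∧ List.Forall₂ (fun b c : Bool => c ≤ b) x.reverse y.reverse ∧
      (false = true ∨ x.reverse ≠ y.reverse)) ↔ MoreOnes x y := by
    simp [MoreOnes, List.forall₂_reverse_iff]
  rw [show decide _ = decide _ from decide_eq_decide.2 e3] at h2
  have h3 := evalsToInTime_mono (evalsToInTime_trans h1 h2)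
    (t := (2 * Polynomial.X + 2 : Polynomial ℕ).eval i.length) (by simp; omega)
  have e4 : initList compMachine (i.map (Equiv.refl (Bool ⊕ Bool)).invFun) =
      compCfg (some false) (none, none, none, true, false) i [] [] := by
    change TM2.Cfg.mk _ _ _ = TM2.Cfg.mk _ _ _
    congr 1
    funext k
    cases k
    · exact List.map_id _
    · rfl
    · rfl
  have e5 : haltList compMachine [decide (MoreOnes x y)] =
      compCfg none (none, none, none, true, false) [] [decide (MoreOnes x y)] [] := by
    change TM2.Cfg.mk _ _ _ = TM2.Cfg.mk _ _ _
    congr 1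
    funext k
    cases k <;> rfl
  rw [← e4, ← e5] at h3
  exact h3

theorem isOK_moreOnes : IsOK MoreOnes where
  isStrictOrder := { irrefl := fun _ h => h.2 rfl, trans := fun _ _ _ h h' => h.trans h' }
  polyTimeDecidable := polyTimeDecidable_moreOnes
  bounded := by
    refine ⟨Polynomial.X + 1, fun l x h => ?_, fun x y h => ?_⟩
    · have := length_le_of_pairwise_moreOnes (n := x.length) h fun w hw => by
        rcases List.mem_append.1 hw with hw | hw
        · exact ((List.pairwise_append.1 h).2.2 w hw x (by simp)).length_eq
        · rw [List.mem_singleton.1 hw]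
      simpa using this
    · simp [h.length_eq]

/-! ### Extensional existential second-order logic -/

theorem Fml.holds_zero_iff {F : Fml 0} {O : Set Word} {x : Word} {n : ℕ} (us : Fin 0 → Fin n) :
    F.holds O x us ↔ F.val O x n 0 0 = true := by
  rw [holds, tupleVal_zero, tupleVal_zero]

theorem Fml.queries_zero {F : Fml 0} {O : Set Word} {x : Word} {n : ℕ} (us : Fin 0 → Fin n) :
    F.queries O x us = F.asks O x n 0 0 := by
  rw [queries, tupleVal_zero, tupleVal_zero]

section

variable {τ : FirstOrder.Language.{0, 0}} (hτ : τ.IsRelational) {k : ℕ}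
  (e : Fin k ≃ Σ r, τ.Relations r) {C : Set (CategoryTheory.Bundled.{0} τ.Structure)}
  {Ψ : ESOSentence τ}

theorem mem_wordsOf_iff_exists_models
    (hC : ∀ A : CategoryTheory.Bundled.{0} τ.Structure,
      A ∈ C ↔ Finite A ∧ Nonempty A ∧ Ψ.Realize A) (x : Word) :
    x ∈ wordsOf e C ↔ Valid e x ∧ ∃ T, Ψ.Models (decodeStructure e hτ x (lead x)) T := by
  rw [mem_wordsOf_iff e hτ]
  refine and_congr_right fun hx => ?_
  rw [hC]
  exact ⟨fun h => h.2.2, fun h => ⟨inferInstanceAs (Finite (Fin (lead x))), ⟨⟨0, hx.1⟩⟩, h⟩⟩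

/-- This is `exists_models_iff` on the level of words: setting a letter in a table keeps the word
valid and the domain size unchanged, so the enlarged structures are again encoded by words of the
same form. -/
theorem mem_wordsOf_iff_base {prime : ∀ r, Ψ.σ.Relations r → τ.Relations r}
    (hC : ∀ A : CategoryTheory.Bundled.{0} τ.Structure,
      A ∈ C ↔ Finite A ∧ Nonempty A ∧ Ψ.Realize A)
    (hprime : ∀ (r : ℕ) (R : Ψ.σ.Relations r), extensionConjunct (prime r R) R ∈ Ψ.conjuncts ∧
      ∀ φ ∈ Ψ.conjuncts, φ ≠ extensionConjunct (prime r R) R →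
        ¬ Occurs (L := τ.sum Ψ.σ) ⟨r, Sum.inl (prime r R)⟩ φ) {x : Word} (hx : Valid e x) :
    (Base e hτ Ψ prime x → x ∈ wordsOf e C) ∧ (¬ Base e hτ Ψ prime x →
      (x ∈ wordsOf e C ↔ ∃ (r : ℕ) (R : Ψ.σ.Relations r) (ts : Fin r → Fin (lead x)),
        ¬ (decodeStructure e hτ x (lead x)).RelMap (prime r R) ts ∧
          addTuple e Ψ prime x R ts ∈ wordsOf e C)) := by
  refine ⟨fun h => (mem_wordsOf_iff_exists_models hτ e hC x).2 ⟨hx, _, h⟩, fun h => ?_⟩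
  rw [mem_wordsOf_iff_exists_models hτ e hC x, and_iff_right hx]
  rw [exists_models_iff hτ hprime h
    (fun R ts => decodeStructure e hτ (addTuple e Ψ prime x R ts) (lead x))
    (fun R ts _ R' ts' => decodeStructure_set e hτ hx (prime _ R) ts R' ts')]
  refine exists_congr fun r => exists_congr fun R => exists_congr fun ts =>
    and_congr_right fun _ => ?_
  have hlt := lead_lt_relPos (e := e) (lead x) (e.symm ⟨r, prime r R⟩) (finFunctionFinEquiv ts)
  rw [mem_wordsOf_iff_exists_models hτ e hC, addTuple, lead_set hlt,
    and_iff_right (valid_set e hx hlt _)]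

/-- A class of finite structures that is expressible in extensional existential second-order logic
is disjunctive self-reducible. -/
theorem disjunctiveSelfReducible_of_expressible (hrel : τ.IsRelational)
    (hC : ExpressibleInExtESO C) :
    DisjunctiveSelfReducible (wordsOf e C) := by
  obtain ⟨Ψ, ⟨prime, -, hprime⟩, hC⟩ := hC
  obtain ⟨p, hp⟩ := (reductionFml e Ψ prime).exists_run
  set F := reductionFml e Ψ prime with hF
  have hus : ∀ n, Nonempty (Fin 0 → Fin n) := fun n => ⟨Fin.elim0⟩
  refine ⟨MoreOnes, isOK_moreOnes, F.machine, ⟨p, fun O x => ⟨_, _, hp O x⟩⟩, ?_, ?_⟩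
  · intro x b qs t hrun
    obtain ⟨rfl, rfl⟩ := hrun.unique (hp _ x)
    obtain ⟨us⟩ := hus (lead x)
    rw [← Fml.holds_zero_iff us, ← Fml.queries_zero us]
    by_cases hx : Valid e x
    · obtain ⟨h1, h2⟩ := mem_wordsOf_iff_base hrel e hC hprime hx
      rw [hF, holds_reductionFml e hrel us hx]
      refine ⟨?_, fun q hq => ?_⟩
      · by_cases hb : Base e hrel Ψ prime x
        · simp [hb, h1 hb]
        · rw [h2 hb]
          simp [hb]
      · obtain ⟨_, r, R, ts, h, rfl⟩ := (mem_queries_reductionFml e hrel us hx q).1 hq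
        exact moreOnes_set ((getElem?_relPos_eq_false e hrel hx _ ts).2 h)
    · obtain ⟨h1, h2⟩ := reductionFml_of_not_valid e (Ψ := Ψ) (prime := prime)
        (O := wordsOf e C) us hx
      rw [hF, h2]
      refine ⟨iff_of_false h1 fun h => hx ((mem_wordsOf_iff e hrel C x).1 h).1, by simp⟩
  · intro x
    obtain ⟨us⟩ := hus (lead x)
    -- Any oracle can serve as the reference for the list of queries; the empty one is taken.
    refine ⟨F.queries ∅ x us, fun O b qs t hrun => ?_, ?_⟩
    · obtain ⟨rfl, rfl⟩ := hrun.unique (hp _ x)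
      rw [← Fml.queries_zero us]
      by_cases hx : Valid e x
      · exact queries_reductionFml_congr e us hrel ∅ hx
      · rw [hF, (reductionFml_of_not_valid e us hx).2, (reductionFml_of_not_valid e us hx).2]
    · by_cases hx : Valid e x
      · by_cases hb : Base e hrel Ψ prime x
        · left
          refine List.eq_nil_iff_forall_not_mem.2 fun q hq => ?_
          exact ((mem_queries_reductionFml e hrel us hx q).1 hq).1 hb
        · right
          rw [(mem_wordsOf_iff_base hrel e hC hprime hx).2 hb]
          simp only [hF, mem_queries_reductionFml e hrel us hx, hb, not_false_eq_true, true_and]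
          constructor
          · rintro ⟨r, R, ts, h, h'⟩
            exact ⟨_, ⟨r, R, ts, h, rfl⟩, h'⟩
          · rintro ⟨_, ⟨r, R, ts, h, rfl⟩, h'⟩
            exact ⟨r, R, ts, h, h'⟩
      · left
        exact (reductionFml_of_not_valid e us hx).2

end

section

open FirstOrder.Language
open scoped FirstOrder

variable {τ : FirstOrder.Language.{0, 0}}

/-! ### Constraint satisfaction problems of finitely bounded structures -/

/-- The elements `a` and `b` can be exchanged for each other in all tuples. -/
def Indist {A : Type} (S : τ.Structure A) (a b : A) : Prop :=
  ∀ (s : Σ r, τ.Relations r) (i : Fin s.1) (z : Fin s.1 → A),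
    S.RelMap s.2 (Function.update z i a) ↔ S.RelMap s.2 (Function.update z i b)

/-- Exchangeability concerns a single coordinate; the coordinates are replaced one after the other,
by induction on the set of those already replaced. -/
theorem Indist.relMap_iff {A : Type} {S : τ.Structure A} {r : ℕ} (R : τ.Relations r)
    {y z : Fin r → A} (h : ∀ i, Indist S (y i) (z i)) : S.RelMap R y ↔ S.RelMap R z := by
  have key : ∀ s : Finset (Fin r),
      S.RelMap R y ↔ S.RelMap R (fun i => if i ∈ s then z i else y i) := by
    intro s
    induction s using Finset.induction_on with
    | empty => simp
    | insert i s hi ih =>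
      have h1 := h i ⟨r, R⟩ i (fun i => if i ∈ s then z i else y i)
      have e1 : Function.update (fun i => if i ∈ s then z i else y i) i (y i) =
          fun i => if i ∈ s then z i else y i := by
        conv_rhs => rw [← Function.update_eq_self i (fun i => if i ∈ s then z i else y i)]
        simp [hi]
      have e2 : Function.update (fun i => if i ∈ s then z i else y i) i (z i) =
          fun j => if j ∈ insert i s then z j else y j := by
        funext j
        by_cases hj : j = i
        · subst hj; simp
        · simp [hj]
      rw [ih, ← e2, ← h1, e1]
  simpa using key Finset.univ

/-- Being exchangeable is an equivalence relation. -/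
def indistSetoid {A : Type} (S : τ.Structure A) : Setoid A where
  r := Indist S
  iseqv :=
    { refl := fun _ _ _ _ => Iff.rfl
      symm := fun h s i z => (h s i z).symm
      trans := fun h h' s i z => (h s i z).trans (h' s i z) }

/-- The function `g` identifies `X` with a substructure of `A` with pairwise distinguishable
elements. -/
def IsCopy {X A : Type} (SX : τ.Structure X) (S : τ.Structure A) (g : X → A) : Prop :=
  (∀ u v, u ≠ v → ¬ Indist S (g u) (g v)) ∧
    ∀ (s : Σ r, τ.Relations r) (ts : Fin s.1 → X), S.RelMap s.2 (g ∘ ts) ↔ SX.RelMap s.2 ts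

/-- A finite structure maps homomorphically to a finitely bounded structure if and only if it can
be extended such that there are no copies of the bounds. -/
theorem nonempty_hom_iff (hτ : τ.IsRelational) {B : Type*} [τ.Structure B]
    {F : Set (CategoryTheory.Bundled.{0} τ.Structure)} (hF : ∀ X ∈ F, Finite X ∧ Nonempty X)
    (hB : ∀ A : CategoryTheory.Bundled.{0} τ.Structure, Finite A → Nonempty A →
      (Nonempty (A ↪[τ] B) ↔ ∀ X ∈ F, IsEmpty (X ↪[τ] A)))
    {A : Type} [S : τ.Structure A] [Finite A] [Nonempty A] :
    Nonempty (A →[τ] B) ↔ ∃ T : τ.Structure A,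
      (∀ {r} (R : τ.Relations r) (ts : Fin r → A), S.RelMap R ts → T.RelMap R ts) ∧
      ∀ X ∈ F, ¬ ∃ g : X → A, IsCopy X.str T g := by
  constructor
  · rintro ⟨φ⟩
    let h : A → B := φ
    have hmap : ∀ {r} (R : τ.Relations r) (ts : Fin r → A), S.RelMap R ts →
      Structure.RelMap R (h ∘ ts) := φ.map_rel
    -- The relations of `B` are pulled back along the homomorphism; this enlarges those of `A`.
    let T : τ.Structure A :=
      { funMap := fun f => ((hτ _).false f).elim
        RelMap := fun R ts => Structure.RelMap R (h ∘ ts) }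
    refine ⟨T, hmap, ?_⟩
    rintro X hX ⟨g, hg1, hg2⟩
    -- Elements with the same image in `B` are exchangeable in `T`, whereas the elements of a copy
    -- are pairwise not.
    have hinj : Function.Injective (h ∘ g) := by
      intro u v huv
      by_contra hne
      refine hg1 u v hne fun s i z => ?_
      change Structure.RelMap s.2 (h ∘ Function.update z i (g u)) ↔
        Structure.RelMap s.2 (h ∘ Function.update z i (g v))
      rw [Function.comp_update, Function.comp_update]
      have : h (g u) = h (g v) := huv
      rw [this]
    have emb : X ↪[τ] B :=
      { toFun := h ∘ g
        inj' := hinj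
        map_fun' := fun f => ((hτ _).false f).elim
        map_rel' := fun R ts => hg2 ⟨_, R⟩ ts }
    have := hF X hX
    -- A bound that embeds into `B` would have no embedding of any bound into itself, but it embeds
    -- into itself by the identity.
    exact ((hB X this.1 this.2).1 ⟨emb⟩ X hX).false (Embedding.refl τ X)
  · rintro ⟨T, hT, hcopy⟩
    let Q := Quotient (indistSetoid T)
    have hout : ∀ a : A, Indist T a (Quotient.out (Quotient.mk (indistSetoid T) a)) := fun a =>
      (indistSetoid T).symm (Quotient.mk_out (s := indistSetoid T) a)
    let SQ : τ.Structure Q :=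
      { funMap := fun f => ((hτ _).false f).elim
        RelMap := fun R ts => T.RelMap R (fun i => (ts i).out) }
    -- Distinct classes have non-exchangeable representatives, so an embedding of a bound into the
    -- quotient would give a copy in `T`.
    have hQ : Nonempty (Q ↪[τ] B) := by
      refine (hB ⟨Q, SQ⟩ (inferInstanceAs (Finite (Quotient _)))
        ⟨Quotient.mk (indistSetoid T) (Classical.arbitrary A)⟩).2 fun X hX => ⟨fun f => hcopy X hX ?_⟩
      refine ⟨fun u => Quotient.out (f u : Q), fun u v huv hind => huv ?_, fun s ts => ?_⟩
      · have h1 : (f u : Q) = f v := by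
          rw [← Quotient.out_eq (f u : Q), ← Quotient.out_eq (f v : Q)]
          exact Quotient.sound (s := indistSetoid T) hind
        exact f.injective h1
      · exact f.map_rel s.2 ts
    obtain ⟨f⟩ := hQ
    refine ⟨@Hom.mk τ A B S _ (fun a => f (Quotient.mk (indistSetoid T) a))
      (fun f => ((hτ _).false f).elim) fun R ts hR => ?_⟩
    refine (f.map_rel R (fun i => Quotient.mk (indistSetoid T) (ts i))).2 ?_
    -- The quotient map preserves relations because each element is exchangeable with the
    -- representative of its class.
    exact (Indist.relMap_iff R fun i => hout (ts i)).1 (hT R ts hR)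

variable [Finite (Σ r, τ.Relations r)]

/-- The formula that says that `a` and `b` can be exchanged for each other. -/
noncomputable def indistFormula {α : Type} (a b : α) : τ.Formula α :=
  Formula.iInf fun q : Σ s : Σ r, τ.Relations r, Fin s.1 => Formula.iAlls (Fin q.1.1)
    ((q.1.2.formula fun j => Term.var (Function.update Sum.inr q.2 (Sum.inl a) j)).iff
      (q.1.2.formula fun j => Term.var (Function.update Sum.inr q.2 (Sum.inl b) j)))

theorem realize_indistFormula {A : Type} [S : τ.Structure A] {α : Type} (a b : α) (v : α → A) :
    (indistFormula (τ := τ) a b).Realize v ↔ Indist S (v a) (v b) := by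
  have key : ∀ {r : ℕ} (z : Fin r → A) (i : Fin r) (a : α),
      (fun j => Sum.elim v z (Function.update Sum.inr i (Sum.inl a) j)) =
        Function.update z i (v a) := by
    intro r z i a
    exact Function.comp_update (Sum.elim v z) Sum.inr i (Sum.inl a)
  simp only [indistFormula, Formula.realize_iInf, Formula.realize_iAlls, Formula.realize_iff,
    Formula.realize_rel, Term.realize_var, key]
  exact ⟨fun h s i z => h ⟨s, i⟩ z, fun h q z => h q.1 q.2 z⟩

open Classical in
/-- The formula that defines the copies of `X`. -/
noncomputable def copyFormula {X : Type} [Finite X] (SX : τ.Structure X) : τ.Formula X :=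
  (Formula.iInf fun p : {p : X × X // p.1 ≠ p.2} => (indistFormula p.1.1 p.1.2).not) ⊓
    Formula.iInf fun q : Σ s : Σ r, τ.Relations r, Fin s.1 → X =>
      if SX.RelMap q.1.2 q.2 then q.1.2.formula fun j => Term.var (q.2 j)
      else (q.1.2.formula fun j => Term.var (q.2 j)).not

theorem realize_copyFormula {A : Type} [S : τ.Structure A] {X : Type} [Finite X]
    (SX : τ.Structure X) (g : X → A) : (copyFormula SX).Realize g ↔ IsCopy SX S g := by
  simp only [copyFormula, Formula.realize_inf, Formula.realize_iInf, Formula.realize_not,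
    realize_indistFormula, IsCopy]
  refine and_congr ⟨fun h u v huv => h ⟨(u, v), huv⟩, fun h p => h _ _ p.2⟩ ?_
  refine ⟨fun h s ts => ?_, fun h q => ?_⟩
  · have h1 := h ⟨s, ts⟩
    split_ifs at h1 with h2
    · exact iff_of_true (by simpa [Function.comp_def] using h1) h2
    · exact iff_of_false (by simpa [Function.comp_def] using h1) h2
  · have h1 := h q.1 q.2
    split_ifs with h2
    · simpa [Function.comp_def] using h1.2 h2
    · simpa [Function.comp_def] using fun h' => h2 (h1.1 h')

/-- The sentence that says that there are no copies of the structures in `F`. -/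
noncomputable def boundsSentence (F : Set (CategoryTheory.Bundled.{0} τ.Structure)) [Finite F]
    (hF : ∀ X ∈ F, Finite X ∧ Nonempty X) : τ.Sentence :=
  Formula.iInf fun X : F =>
    haveI := (hF X.1 X.2).1
    (Formula.iExs X.1 ((copyFormula X.1.str).relabel Sum.inr)).not

theorem realize_boundsSentence {A : Type} [S : τ.Structure A]
    (F : Set (CategoryTheory.Bundled.{0} τ.Structure)) [Finite F]
    (hF : ∀ X ∈ F, Finite X ∧ Nonempty X) :
    A ⊨ boundsSentence F hF ↔ ∀ X ∈ F, ¬ ∃ g : X → A, IsCopy X.str S g := by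
  simp only [Sentence.Realize, boundsSentence, Formula.realize_iInf, Formula.realize_not,
    Subtype.forall]
  refine forall₂_congr fun X hX => not_congr ?_
  have := (hF X hX).1
  rw [Formula.realize_iExs]
  refine exists_congr fun g => ?_
  rw [Formula.realize_relabel, Sum.elim_comp_inr]
  exact realize_copyFormula _ _

end

/-! ### The extensional sentence for a constraint satisfaction problem -/

theorem occurs_alls {L : FirstOrder.Language.{0, 0}} {α : Type} (s : Σ r, L.Relations r) {n : ℕ}
    (φ : L.BoundedFormula α n) : Occurs s φ.alls ↔ Occurs s φ := by
  induction n with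
  | zero => exact Iff.rfl
  | succ n ih => exact ih φ.all

theorem not_occurs_sumInr {τ σ : FirstOrder.Language.{0, 0}} {r : ℕ} (R : τ.Relations r) {α : Type}
    {n : ℕ} (φ : σ.BoundedFormula α n) : ¬ Occurs (L := τ.sum σ) ⟨r, Sum.inl R⟩
      ((FirstOrder.Language.LHom.sumInr : σ →ᴸ τ.sum σ).onBoundedFormula φ) := by
  induction φ with
  | falsum => exact id
  | equal t u => exact id
  | rel R' ts =>
    intro h
    obtain ⟨rfl, h2⟩ := Sigma.mk.inj_iff.1 h
    exact Sum.inl_ne_inr (eq_of_heq h2)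
  | imp φ ψ ih ih' => exact fun h => h.elim ih ih'
  | all φ ih => exact ih

/-- The constraint satisfaction problem of a finitely bounded structure is expressible in
extensional existential second-order logic. -/
theorem expressibleInExtESO_CSP {τ : FirstOrder.Language.{0, 0}} (hτ : τ.IsRelational) {k : ℕ}
    (e : Fin k ≃ Σ r, τ.Relations r) {B : Type*} [τ.Structure B] (hB : FinitelyBounded τ B) :
    ExpressibleInExtESO (CSP (τ := τ) B) := by
  obtain ⟨F, hfin, hF, hB⟩ := hB
  have : Finite (Σ r, τ.Relations r) := Finite.of_equiv _ e
  have : Finite F := hfin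
  let bounds : (τ.sum τ).Sentence :=
    (FirstOrder.Language.LHom.sumInr : τ →ᴸ τ.sum τ).onSentence (boundsSentence F hF)
  have hbounds : ∀ {A : Type} (S T : τ.Structure A),
      @FirstOrder.Language.Sentence.Realize (τ.sum τ) A
        (@FirstOrder.Language.sumStructure τ τ A S T) bounds ↔
      ∀ X ∈ F, ¬ ∃ g : X → A, IsCopy X.str T g := by
    intro A S T
    refine Iff.trans ?_ (realize_boundsSentence (S := T) F hF)
    exact @FirstOrder.Language.LHom.realize_onSentence τ (τ.sum τ) A T
      (@FirstOrder.Language.sumStructure τ τ A S T) _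
      (@FirstOrder.Language.LHom.sumInr_isExpansionOn τ τ A S T) _
  -- The quantified signature is a second copy of `τ`, each symbol being partnered with its
  -- original. The bounds are expressed in the second copy only, so no original symbol occurs there.
  let Ψ : ESOSentence τ :=
    { σ := τ
      relational := hτ
      finite := inferInstance
      conjuncts := (List.finRange k).map (fun i => extensionConjunct (e i).2 (e i).2) ++ [bounds] }
  have hmem : ∀ φ, φ ∈ Ψ.conjuncts ↔
      (∃ s : Σ r, τ.Relations r, extensionConjunct s.2 s.2 = φ) ∨ φ = bounds := by
    intro φ
    simp only [Ψ, List.mem_append, List.mem_map, List.mem_finRange, true_and, List.mem_singleton]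
    refine or_congr_left ⟨?_, ?_⟩
    · rintro ⟨i, h⟩
      exact ⟨e i, h⟩
    · rintro ⟨s, h⟩
      obtain ⟨i, rfl⟩ := e.surjective s
      exact ⟨i, h⟩
  refine ⟨Ψ, ⟨fun _ R => R, fun _ => Function.injective_id, fun r R => ⟨?_, ?_⟩⟩, ?_⟩
  · exact (hmem _).2 (Or.inl ⟨⟨r, R⟩, rfl⟩)
  · intro φ hφ hne hocc
    rcases (hmem φ).1 hφ with ⟨s, rfl⟩ | h
    -- An extension conjunct has a symbol of the first copy only in its premise, so an occurrence of
    -- `R` there forces the conjunct to be the one for `R`.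
    · rcases (occurs_alls _ _).1 hocc with h | h
      · obtain ⟨rfl, h2⟩ := Sigma.mk.inj_iff.1 h
        have h3 : R = s.2 := Sum.inl_injective (eq_of_heq h2)
        exact hne (h3 ▸ rfl)
      · obtain ⟨rfl, h2⟩ := Sigma.mk.inj_iff.1 h
        exact Sum.inl_ne_inr (eq_of_heq h2)
    · rw [h] at hocc
      exact not_occurs_sumInr R _ hocc
  · intro A
    refine and_congr_right fun h1 => and_congr_right fun h2 => ?_
    refine (nonempty_hom_iff hτ hF hB (A := A)).trans ?_
    refine exists_congr fun T => ?_
    constructor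
    · rintro ⟨hT, hcopy⟩ φ hφ
      rcases (hmem φ).1 hφ with ⟨s, rfl⟩ | h
      · exact (realize_extensionConjunct A.str T s.2 s.2).2 (hT s.2)
      · rw [h]
        exact (hbounds A.str T).2 hcopy
    · intro h
      refine ⟨fun R ts => (realize_extensionConjunct A.str T R R).1
        (h _ ((hmem _).2 (Or.inl ⟨⟨_, R⟩, rfl⟩))) ts, ?_⟩
      exact (hbounds A.str T).1 (h _ ((hmem _).2 (Or.inr rfl)))

end SelfRed

theorem mainTheorem8 {τ : FirstOrder.Language.{0, 0}} (hτ : τ.IsRelational) {k : ℕ}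
    (e : Fin k ≃ Σ r, τ.Relations r) :
    (∀ C : Set (CategoryTheory.Bundled.{0} τ.Structure), SelfRed.ExpressibleInExtESO C →
      SelfRed.DisjunctiveSelfReducible (SelfRed.wordsOf e C)) ∧
    (∀ (B : Type*) [τ.Structure B] [Nonempty B], SelfRed.FinitelyBounded τ B →
      SelfRed.DisjunctiveSelfReducible (SelfRed.wordsOf e (SelfRed.CSP (τ := τ) B))) :=
  ⟨fun _ hC => SelfRed.disjunctiveSelfReducible_of_expressible e hτ hC, fun _ _ _ hB =>
    SelfRed.disjunctiveSelfReducible_of_expressible e hτ (SelfRed.expressibleInExtESO_CSP hτ e hB)⟩
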